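/- Let $p$ be a prime, let $L$ be a finite extension of $\mathbb{Q}_p$ with its $p$-adic absolute value $|\cdot|$, and let $M\ge 0$ be an integer. Let $S_M=L\langle p^{-M}T\rangle$ be the Banach algebra of power series $\sum_{i\ge 0}a_iT^i$ with $a_i\in L$ and $|a_i|p^{-Mi}\to 0$, with norm $\sup_i |a_i|p^{-Mi}$ (functions on the closed disk $|T|\le p^{-M}$). Let $S_{M,M+1}=L\langle p^{-M}T,p^{M+1}T^{-1}\rangle$ be the Banach algebra of series $\sum_{i\in\mathbb{Z}}a_iT^i$ with $a_i\in L$, $|a_i|p^{-Mi}\to 0$ as $i\to\infty$ and $|a_i|p^{-(M+1)i}\to 0$ as $i\to-\infty$, with norm $\max\{\sup_i|a_i|p^{-Mi},\,\sup_i|a_i|p^{-(M+1)i}\}$ (functions on the closed annulus $p^{-(M+1)}\le|T|\le p^{-M}$). Let $\mathbf{A}_{\inf}=W(\mathcal{O}_{\mathbb{C}_p}^{\flat})$ and let $\theta:\mathbf{A}_{\inf}[1/p]\to\mathbb{C}_p$ be Fontaine's map. Let $\mathbf{B}_{\mathrm{dR}}^+=\varprojlim_i \mathbf{A}_{\inf}[1/p]/(\ker\theta)^i$,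 with the Fréchet topology of the inverse limit of the $p$-adic Banach spaces $\mathbf{B}_{\mathrm{dR}}^+/(t^i)=\mathbf{A}_{\inf}[1/p]/(\ker\theta)^i$, in which the image of $\mathbf{A}_{\inf}$ is the unit ball. Let $\mathbf{B}_{\mathrm{crys}}^+=\mathbf{A}_{\mathrm{crys}}[1/p]\subset\mathbf{B}_{\mathrm{dR}}^+$ be the $p$-adic Banach space with unit ball $\mathbf{A}_{\mathrm{crys}}$, where $\mathbf{A}_{\mathrm{crys}}$ is the $p$-adic completion of the $\mathbf{A}_{\inf}$-subalgebra of $\mathbf{A}_{\inf}[1/p]$ generated by all $y^n/n!$ with $y\in\mathbf{A}_{\inf}\cap\ker\theta$, $n\ge0$. All completed tensor products are Hausdorff completions of projective tensor products over $\mathbb{Q}_p$. Then the natural maps from $S_M\widehat\otimes_{\mathbb{Q}_p}\mathbf{B}_{\mathrm{dR}}^+$, $S_{M,M+1}\widehat\otimes_{\mathbb{Q}_p}\mathbf{B}_{\mathrm{crys}}^+$ and $S_M\widehat\otimes_{\mathbb{Q}_p}\mathbf{B}_{\mathrm{crys}}^+$ to the Fréchet space $S_{M,M+1}\widehat\otimes_{\mathbb{Q}_p}\mathbf{B}_{\mathrm{dR}}^+$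 are injective, and, identifying the three spaces with their images, \[S_M\widehat\otimes_{\mathbb{Q}_p}\mathbf{B}_{\mathrm{dR}}^+\;\cap\; S_{M,M+1}\widehat\otimes_{\mathbb{Q}_p}\mathbf{B}_{\mathrm{crys}}^+\;=\;S_M\widehat\otimes_{\mathbb{Q}_p}\mathbf{B}_{\mathrm{crys}}^+ .\] -/

import Mathlib

/-! ### The ring of integers of `ℂ_p` is `p`-adically complete -/

section PadicComplexInt

open Filter Topology
open scoped NNReal

theorem PadicComplexInt.norm_eq_coe_valuation (p : ℕ) [Fact p.Prime] (x : ℂ_[p]) :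
    ‖x‖ = ((Valued.v x : ℝ≥0) : ℝ) := by
  rw [PadicComplex.norm_eq_norm]
  simp only [Valued.v.norm_def, PadicComplex.RankOne.hom_eq_embedding]
  rw [Valuation.embedding_restrict (PadicComplex.valued p).v x]

theorem PadicComplexInt.norm_le_one (p : ℕ) [Fact p.Prime] (x : ℂ_[p]) :
    x ∈ 𝓞_ℂ_[p] ↔ ‖x‖ ≤ 1 := by
  rw [PadicComplexInt.norm_eq_coe_valuation]
  norm_cast

theorem PadicComplexInt.mem_span_pow (p : ℕ) [Fact p.Prime] (n : ℕ) (x : 𝓞_ℂ_[p]) :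
    x ∈ (Ideal.span {(p : 𝓞_ℂ_[p])} ^ n • (⊤ : Submodule 𝓞_ℂ_[p] 𝓞_ℂ_[p])) ↔
      ‖(x : ℂ_[p])‖ ≤ ((p : ℝ)⁻¹) ^ n := by
  have hp : (p : ℂ_[p]) ≠ 0 := by exact_mod_cast (Fact.out : p.Prime).ne_zero
  have hpn : ‖(p : ℂ_[p])‖ = (p : ℝ)⁻¹ := by
    rw [PadicComplexInt.norm_eq_coe_valuation, PadicComplex.valuation_p]; simp
  have hp0 : (0 : ℝ) < (p : ℝ)⁻¹ := by
    have := (Fact.out : p.Prime).pos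
    positivity
  rw [smul_eq_mul, Ideal.mul_top, Ideal.span_singleton_pow, Ideal.mem_span_singleton]
  constructor
  · rintro ⟨y, rfl⟩
    have hy := (PadicComplexInt.norm_le_one p (y : ℂ_[p])).1 y.2
    push_cast
    rw [norm_mul, norm_pow, hpn]
    exact mul_le_of_le_one_right (by positivity) hy
  · intro h
    have hy : (x : ℂ_[p]) / (p : ℂ_[p]) ^ n ∈ 𝓞_ℂ_[p] := by
      rw [PadicComplexInt.norm_le_one, norm_div, norm_pow, hpn]
      exact div_le_one_of_le₀ h (by positivity)
    refine ⟨⟨_, hy⟩, Subtype.ext ?_⟩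
    push_cast
    field_simp

instance PadicComplexInt.fact_not_isUnit (p : ℕ) [Fact p.Prime] :
    Fact (¬ IsUnit (p : 𝓞_ℂ_[p])) := ⟨fun h => by
  have h1 : (1 : 𝓞_ℂ_[p]) ∈
      (Ideal.span {(p : 𝓞_ℂ_[p])} ^ 1 • (⊤ : Submodule 𝓞_ℂ_[p] 𝓞_ℂ_[p])) := by
    rw [smul_eq_mul, Ideal.mul_top, pow_one, Ideal.mem_span_singleton]
    exact h.dvd
  rw [PadicComplexInt.mem_span_pow] at h1
  have h2 : (1 : ℝ) < p := by exact_mod_cast (Fact.out : p.Prime).one_lt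
  have h3 := inv_lt_one_of_one_lt₀ h2
  simp only [OneMemClass.coe_one, norm_one, pow_one] at h1
  linarith⟩

instance PadicComplexInt.isAdicComplete (p : ℕ) [Fact p.Prime] :
    IsAdicComplete (Ideal.span {(p : 𝓞_ℂ_[p])}) 𝓞_ℂ_[p] where
  haus' x hx := by
    have h2 : (1 : ℝ) < p := by exact_mod_cast (Fact.out : p.Prime).one_lt
    have h3 : Tendsto (fun n : ℕ => ((p : ℝ)⁻¹) ^ n) atTop (𝓝 0) :=
      tendsto_pow_atTop_nhds_zero_of_lt_one (by positivity) (inv_lt_one_of_one_lt₀ h2)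
    have h4 : ‖(x : ℂ_[p])‖ ≤ 0 := ge_of_tendsto' h3 fun n => by
      have := hx n
      rw [SModEq.zero, PadicComplexInt.mem_span_pow] at this
      exact this
    exact Subtype.ext (norm_le_zero_iff.1 h4)
  prec' f hf := by
    have h2 : (1 : ℝ) < p := by exact_mod_cast (Fact.out : p.Prime).one_lt
    have h3 : Tendsto (fun n : ℕ => ((p : ℝ)⁻¹) ^ n) atTop (𝓝 0) :=
      tendsto_pow_atTop_nhds_zero_of_lt_one (by positivity) (inv_lt_one_of_one_lt₀ h2)
    have h4 : ∀ m n, m ≤ n → dist (f m : ℂ_[p]) (f n) ≤ ((p : ℝ)⁻¹) ^ m := fun m n h => by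
      have := hf h
      rw [SModEq.sub_mem, PadicComplexInt.mem_span_pow] at this
      rw [dist_eq_norm]
      exact_mod_cast this
    have h5 : CauchySeq (fun n => (f n : ℂ_[p])) :=
      cauchySeq_of_le_tendsto_0' _ (fun n m h => h4 n m h) h3
    obtain ⟨y, hy⟩ := cauchySeq_tendsto_of_complete h5
    have hy1 : y ∈ 𝓞_ℂ_[p] := by
      rw [PadicComplexInt.norm_le_one]
      exact le_of_tendsto' hy.norm fun n => (PadicComplexInt.norm_le_one p _).1 (f n).2
    refine ⟨⟨y, hy1⟩, fun n => ?_⟩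
    rw [SModEq.sub_mem, PadicComplexInt.mem_span_pow]
    have h6 : Tendsto (fun k => dist (f n : ℂ_[p]) (f k)) atTop (𝓝 (dist (f n : ℂ_[p]) y)) :=
      tendsto_const_nhds.dist hy
    have h7 : dist (f n : ℂ_[p]) y ≤ ((p : ℝ)⁻¹) ^ n :=
      le_of_tendsto h6 (eventually_atTop.2 ⟨n, fun k hk => h4 n k hk⟩)
    rw [dist_eq_norm] at h7
    exact_mod_cast h7

end PadicComplexInt

namespace PadicPeriod

noncomputable section

/-! ### Group topologies given by families of subgroups -/

/-- The filter basis of a directed family of subgroups `B i` of an abelian group: for the attached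
group topology the `B i` form a basis of neighbourhoods of `0`. -/
@[reducible]
def subgroupsBasis {G ι : Type*} [AddCommGroup G] [Nonempty ι] (B : ι → AddSubgroup G)
    (hB : ∀ i j, ∃ k, B k ≤ B i ⊓ B j) : AddGroupFilterBasis G :=
  addGroupFilterBasisOfComm {U | ∃ i, U = (B i : Set G)}
    (let ⟨i⟩ := ‹Nonempty ι›; ⟨B i, i, rfl⟩)
    (by
      rintro _ _ ⟨i, rfl⟩ ⟨j, rfl⟩
      obtain ⟨k, hk⟩ := hB i j
      exact ⟨B k, ⟨k, rfl⟩, hk⟩)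
    (by rintro _ ⟨i, rfl⟩; exact (B i).zero_mem)
    (by
      rintro _ ⟨i, rfl⟩
      refine ⟨B i, ⟨i, rfl⟩, ?_⟩
      rintro _ ⟨x, hx, y, hy, rfl⟩
      exact (B i).add_mem hx hy)
    (by
      rintro _ ⟨i, rfl⟩
      exact ⟨B i, ⟨i, rfl⟩, fun x hx => (B i).neg_mem hx⟩)

theorem subgroupsBasis_hasBasis {G ι : Type*} [AddCommGroup G] [Nonempty ι]
    (B : ι → AddSubgroup G) (hB : ∀ i j, ∃ k, B k ≤ B i ⊓ B j) :
    (@nhds G (subgroupsBasis B hB).topology 0).HasBasis (fun _ => True)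
      (fun i => (B i : Set G)) := by
  refine ⟨fun t => ?_⟩
  rw [(subgroupsBasis B hB).nhds_zero_hasBasis.mem_iff]
  constructor
  · rintro ⟨_, ⟨i, rfl⟩, h⟩
    exact ⟨i, trivial, h⟩
  · rintro ⟨i, -, h⟩
    exact ⟨_, ⟨i, rfl⟩, h⟩

/-- A homomorphism of topological groups is continuous if the preimage of each member of a basis of
subgroups of the target contains an open subgroup of the source. -/
theorem continuous_of_subgroupsBasis {G H ι κ : Type*} [AddCommGroup G] [AddCommGroup H]
    [Nonempty ι] [Nonempty κ] (B : ι → AddSubgroup G) (hB : ∀ i j, ∃ k, B k ≤ B i ⊓ B j)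
    (C : κ → AddSubgroup H) (hC : ∀ i j, ∃ k, C k ≤ C i ⊓ C j) (f : G →+ H)
    (h : ∀ k, ∃ i, ∀ x ∈ B i, f x ∈ C k) :
    @Continuous G H (subgroupsBasis B hB).topology (subgroupsBasis C hC).topology f := by
  let _ := (subgroupsBasis B hB).topology
  let _ := (subgroupsBasis C hC).topology
  have : IsTopologicalAddGroup G := (subgroupsBasis B hB).isTopologicalAddGroup
  have : IsTopologicalAddGroup H := (subgroupsBasis C hC).isTopologicalAddGroup
  refine continuous_of_continuousAt_zero f ?_
  rw [ContinuousAt, map_zero,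
    (subgroupsBasis_hasBasis B hB).tendsto_iff (subgroupsBasis_hasBasis C hC)]
  intro k _
  obtain ⟨i, hi⟩ := h k
  exact ⟨i, trivial, hi⟩

/-- The subgroups `p ^ n • Λ` of an abelian group. -/
def latticeFamily {G : Type*} [AddCommGroup G] (p : ℕ) (Λ : AddSubgroup G) (n : ℕ) :
    AddSubgroup G :=
  Λ.map (nsmulAddMonoidHom (p ^ n))

theorem latticeFamily_directed {G : Type*} [AddCommGroup G] (p : ℕ) (Λ : AddSubgroup G)
    (m n : ℕ) : ∃ k, latticeFamily p Λ k ≤ latticeFamily p Λ m ⊓ latticeFamily p Λ n := by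
  have key : ∀ a b : ℕ, latticeFamily p Λ (a + b) ≤ latticeFamily p Λ a := by
    rintro a b _ ⟨x, hx, rfl⟩
    refine ⟨p ^ b • x, Λ.nsmul_mem hx _, ?_⟩
    simp [pow_add, mul_smul]
  refine ⟨m + n, le_inf (key m n) ?_⟩
  rw [add_comm]
  exact key n m

/-- The topology with basis of neighbourhoods of `0` the subgroups `p ^ n • Λ`. If `Λ` is the unit
ball of a `p`-adic Banach space this is its Banach topology. -/
@[reducible]
def latticeTopology {G : Type*} [AddCommGroup G] (p : ℕ) (Λ : AddSubgroup G) :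
    TopologicalSpace G :=
  (subgroupsBasis (latticeFamily p Λ) (latticeFamily_directed p Λ)).topology

/-! ### Completed projective tensor products over `ℚ_[p]` -/

open scoped TensorProduct

section CompletedTensor

variable (p : ℕ) [Fact p.Prime]

/-- The algebraic tensor product `V ⊗ W` over `ℚ_[p]`, to be given the projective topology. -/
def ProjTensor (V W : Type*) [AddCommGroup V] [Module ℚ_[p] V] [AddCommGroup W]
    [Module ℚ_[p] W] : Type _ :=
  V ⊗[ℚ_[p]] W

variable (V W V' W' : Type*)
  [AddCommGroup V] [Module ℚ_[p] V] [TopologicalSpace V]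
  [AddCommGroup W] [Module ℚ_[p] W] [TopologicalSpace W]
  [AddCommGroup V'] [Module ℚ_[p] V'] [TopologicalSpace V']
  [AddCommGroup W'] [Module ℚ_[p] W'] [TopologicalSpace W']

instance : AddCommGroup (ProjTensor p V W) := inferInstanceAs (AddCommGroup (V ⊗[ℚ_[p]] W))

instance : Module ℚ_[p] (ProjTensor p V W) := inferInstanceAs (Module ℚ_[p] (V ⊗[ℚ_[p]] W))

/-- For open subgroups `A` of `V` and `B` of `W`, the subgroup of `V ⊗ W` generated by the pure
tensors `a ⊗ b` with `a ∈ A` and `b ∈ B`. In a topological `ℚ_[p]`-vector space every open subgroup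
is a `ℤ_[p]`-submodule (`ℤ` is dense in `ℤ_[p]` and open subgroups are closed), so this is the image
of the tensor product over `ℤ_[p]` of two open lattices. -/
def tensorFamily (AB : OpenAddSubgroup V × OpenAddSubgroup W) : AddSubgroup (ProjTensor p V W) :=
  AddSubgroup.closure {z | ∃ a ∈ AB.1, ∃ b ∈ AB.2, z = (a ⊗ₜ[ℚ_[p]] b : V ⊗[ℚ_[p]] W)}

theorem tensorFamily_directed (i j : OpenAddSubgroup V × OpenAddSubgroup W) :
    ∃ k, tensorFamily p V W k ≤ tensorFamily p V W i ⊓ tensorFamily p V W j := by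
  refine ⟨(i.1 ⊓ j.1, i.2 ⊓ j.2), le_inf ?_ ?_⟩
  · refine AddSubgroup.closure_mono ?_
    rintro _ ⟨a, ha, b, hb, rfl⟩
    exact ⟨a, ha.1, b, hb.1, rfl⟩
  · refine AddSubgroup.closure_mono ?_
    rintro _ ⟨a, ha, b, hb, rfl⟩
    exact ⟨a, ha.2, b, hb.2, rfl⟩

/-- The projective tensor product topology on `V ⊗ W`, for locally convex `V` and `W`. -/
instance : TopologicalSpace (ProjTensor p V W) :=
  (subgroupsBasis (tensorFamily p V W) (tensorFamily_directed p V W)).topology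

instance : IsTopologicalAddGroup (ProjTensor p V W) :=
  (subgroupsBasis (tensorFamily p V W) (tensorFamily_directed p V W)).isTopologicalAddGroup

instance : UniformSpace (ProjTensor p V W) := IsTopologicalAddGroup.rightUniformSpace _

instance : IsUniformAddGroup (ProjTensor p V W) := isUniformAddGroup_of_addCommGroup

/-- The completed tensor product of `V` and `W` over `ℚ_[p]`: the Hausdorff completion of the
projective tensor product. -/
abbrev CompletedTensor : Type _ := UniformSpace.Completion (ProjTensor p V W)

variable {V W V' W'}

/-- The map `f ⊗ g` on algebraic tensor products. -/
def projTensorMap (f : V →L[ℚ_[p]] V') (g : W →L[ℚ_[p]] W') :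
    ProjTensor p V W →+ ProjTensor p V' W' :=
  (TensorProduct.map (f : V →ₗ[ℚ_[p]] V') (g : W →ₗ[ℚ_[p]] W')).toAddMonoidHom

theorem continuous_projTensorMap (f : V →L[ℚ_[p]] V') (g : W →L[ℚ_[p]] W') :
    Continuous (projTensorMap p f g) := by
  refine continuous_of_subgroupsBasis _ _ _ _ (projTensorMap p f g) ?_
  rintro ⟨A, B⟩
  refine ⟨(A.comap (f : V →+ V') f.continuous, B.comap (g : W →+ W') g.continuous), ?_⟩
  intro x hx
  have : tensorFamily p V W
      (A.comap (f : V →+ V') f.continuous, B.comap (g : W →+ W') g.continuous) ≤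
      (tensorFamily p V' W' (A, B)).comap (projTensorMap p f g) := by
    refine (AddSubgroup.closure_le _).2 ?_
    rintro _ ⟨a, ha, b, hb, rfl⟩
    exact AddSubgroup.subset_closure ⟨f a, ha, g b, hb, rfl⟩
  exact this hx

/-- The map induced by `f ⊗ g` on completed tensor products. -/
def CompletedTensor.map (f : V →L[ℚ_[p]] V') (g : W →L[ℚ_[p]] W') :
    CompletedTensor p V W →+ CompletedTensor p V' W' :=
  (projTensorMap p f g).completion (continuous_projTensorMap p f g)

end CompletedTensor

/-! ### The disk algebra and the annulus algebra -/

section Affinoid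

open Filter Topology

variable (p : ℕ) [Fact p.Prime] (L : Type*) [NormedField L] [NormedAlgebra ℚ_[p] L]

/-- The radius `p ^ (-n)`. -/
def radius (n : ℕ) : ℝ := (p : ℝ) ^ (-(n : ℤ))

theorem radius_pos (n : ℕ) : 0 < radius p n :=
  zpow_pos (by exact_mod_cast (Fact.out : p.Prime).pos) _

theorem radius_anti {n n' : ℕ} (h : n ≤ n') : radius p n' ≤ radius p n :=
  zpow_le_zpow_right₀ (by exact_mod_cast (Fact.out : p.Prime).one_lt.le) (by omega)

/-- The ring `L⟨p ^ (-n) T⟩` of functions on the closed disk `|T| ≤ p ^ (-n)`: the power series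
`∑ a i T ^ i` with `|a i| p ^ (-n i) → 0`. -/
def Disk (n : ℕ) : Submodule ℚ_[p] (PowerSeries L) where
  carrier := {f | PowerSeries.IsRestricted (radius p n) f}
  add_mem' hf hg := PowerSeries.isRestricted.add _ hf hg
  zero_mem' := PowerSeries.isRestricted_zero _
  smul_mem' c f hf := by
    have hf' := (PowerSeries.isRestricted_iff' _ _).1 hf
    refine (PowerSeries.isRestricted_iff' _ _).2 ?_
    have := hf'.const_mul ‖c‖
    rw [mul_zero] at this
    refine this.congr fun i => ?_
    rw [show PowerSeries.coeff i (c • f) = c • PowerSeries.coeff i f from rfl, norm_smul, mul_assoc]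

/-- The ring `L⟨p ^ (-n) T, p ^ n' T⁻¹⟩` of functions on the closed annulus
`p ^ (-n') ≤ |T| ≤ p ^ (-n)`: the two-sided series `∑ a i T ^ i` with `|a i| p ^ (-n i) → 0` for
`i → ∞` and `|a i| p ^ (-n' i) → 0` for `i → -∞`. -/
def Annulus (n n' : ℕ) : Submodule ℚ_[p] (ℤ → L) where
  carrier := {a | Tendsto (fun i : ℤ => ‖a i‖ * radius p n ^ i) atTop (𝓝 0) ∧
    Tendsto (fun i : ℤ => ‖a i‖ * radius p n' ^ i) atBot (𝓝 0)}
  add_mem' := by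
    have key : ∀ (l : Filter ℤ) (m : ℕ) (a b : ℤ → L),
        Tendsto (fun i : ℤ => ‖a i‖ * radius p m ^ i) l (𝓝 0) →
        Tendsto (fun i : ℤ => ‖b i‖ * radius p m ^ i) l (𝓝 0) →
        Tendsto (fun i : ℤ => ‖(a + b) i‖ * radius p m ^ i) l (𝓝 0) := by
      intro l m a b ha hb
      have hab := ha.add hb
      rw [add_zero] at hab
      have hr := fun i : ℤ => (zpow_pos (radius_pos p m) i).le
      refine squeeze_zero (fun i => mul_nonneg (norm_nonneg _) (hr i)) (fun i => ?_) hab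
      rw [← add_mul]
      exact mul_le_mul_of_nonneg_right (norm_add_le _ _) (hr i)
    intro a b ha hb
    exact ⟨key _ _ _ _ ha.1 hb.1, key _ _ _ _ ha.2 hb.2⟩
  zero_mem' := by simp
  smul_mem' c a ha := by
    have key : ∀ (l : Filter ℤ) (m : ℕ),
        Tendsto (fun i : ℤ => ‖a i‖ * radius p m ^ i) l (𝓝 0) →
        Tendsto (fun i : ℤ => ‖(c • a) i‖ * radius p m ^ i) l (𝓝 0) := by
      intro l m h
      have := h.const_mul ‖c‖
      rw [mul_zero] at this
      refine this.congr fun i => ?_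
      rw [Pi.smul_apply, norm_smul, mul_assoc]
    exact ⟨key _ _ ha.1, key _ _ ha.2⟩

theorem norm_add_mul_le (p : ℕ) [Fact p.Prime] {L : Type*} [NormedField L] [NormedAlgebra ℚ_[p] L]
    (a b : L) {r ε : ℝ} (hr : 0 ≤ r) (ha : ‖a‖ * r ≤ ε) (hb : ‖b‖ * r ≤ ε) :
    ‖a + b‖ * r ≤ ε := by
  have : IsUltrametricDist L := IsUltrametricDist.of_normedAlgebra ℚ_[p]
  refine (mul_le_mul_of_nonneg_right (IsUltrametricDist.norm_add_le_max a b) hr).trans ?_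
  rcases max_cases ‖a‖ ‖b‖ with h | h <;> rw [h.1] <;> assumption

/-- The ball of radius `ε` of `L⟨p ^ (-n) T⟩` for the Banach norm `sup |a i| p ^ (-n i)`. -/
def diskBall (n : ℕ) (ε : {ε : ℝ // 0 < ε}) : AddSubgroup (Disk p L n) where
  carrier := {f | ∀ i : ℕ, ‖PowerSeries.coeff i (f : PowerSeries L)‖ * radius p n ^ i ≤ ε}
  add_mem' hf hg i := by
    simpa using norm_add_mul_le p _ _ (pow_pos (radius_pos p n) i).le (hf i) (hg i)
  zero_mem' i := by simpa using ε.2.le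
  neg_mem' hf i := by simpa using hf i

/-- The ball of radius `ε` of `L⟨p ^ (-n) T, p ^ n' T⁻¹⟩` for the Banach norm
`max (sup |a i| p ^ (-n i)) (sup |a i| p ^ (-n' i))`. -/
def annulusBall (n n' : ℕ) (ε : {ε : ℝ // 0 < ε}) : AddSubgroup (Annulus p L n n') where
  carrier := {a | ∀ i : ℤ, ‖(a : ℤ → L) i‖ * radius p n ^ i ≤ ε ∧
    ‖(a : ℤ → L) i‖ * radius p n' ^ i ≤ ε}
  add_mem' hf hg i :=
    ⟨norm_add_mul_le p _ _ (zpow_pos (radius_pos p n) i).le (hf i).1 (hg i).1,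
      norm_add_mul_le p _ _ (zpow_pos (radius_pos p n') i).le (hf i).2 (hg i).2⟩
  zero_mem' i := by simpa using ε.2.le
  neg_mem' hf i := by simpa using hf i

theorem diskBall_directed (n : ℕ) (i j : {ε : ℝ // 0 < ε}) :
    ∃ k, diskBall p L n k ≤ diskBall p L n i ⊓ diskBall p L n j :=
  ⟨⟨min i.1 j.1, lt_min i.2 j.2⟩, fun _ hf =>
    ⟨fun m => (hf m).trans (min_le_left _ _), fun m => (hf m).trans (min_le_right _ _)⟩⟩

theorem annulusBall_directed (n n' : ℕ) (i j : {ε : ℝ // 0 < ε}) :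
    ∃ k, annulusBall p L n n' k ≤ annulusBall p L n n' i ⊓ annulusBall p L n n' j :=
  ⟨⟨min i.1 j.1, lt_min i.2 j.2⟩, fun _ hf =>
    ⟨fun m => ⟨(hf m).1.trans (min_le_left _ _), (hf m).2.trans (min_le_left _ _)⟩,
      fun m => ⟨(hf m).1.trans (min_le_right _ _), (hf m).2.trans (min_le_right _ _)⟩⟩⟩

instance : Nonempty {ε : ℝ // 0 < ε} := ⟨⟨1, one_pos⟩⟩

/-- The Banach topology of `L⟨p ^ (-n) T⟩`. -/
instance (n : ℕ) : TopologicalSpace (Disk p L n) :=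
  (subgroupsBasis (diskBall p L n) (diskBall_directed p L n)).topology

/-- The Banach topology of `L⟨p ^ (-n) T, p ^ n' T⁻¹⟩`. -/
instance (n n' : ℕ) : TopologicalSpace (Annulus p L n n') :=
  (subgroupsBasis (annulusBall p L n n') (annulusBall_directed p L n n')).topology

/-- The two-sided sequence of coefficients of a power series. -/
def twoSided (f : PowerSeries L) (i : ℤ) : L :=
  if 0 ≤ i then PowerSeries.coeff i.toNat f else 0

theorem toNat_tendsto : Tendsto Int.toNat atTop atTop :=
  tendsto_atTop.2 fun n => (eventually_ge_atTop (n : ℤ)).mono fun i hi => by omega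

theorem twoSided_mem (n n' : ℕ) {f : PowerSeries L} (hf : f ∈ Disk p L n) :
    twoSided L f ∈ Annulus p L n n' := by
  constructor
  · have h := (PowerSeries.isRestricted_iff' _ _).1 hf
    have h' := h.comp toNat_tendsto
    refine h'.congr' ?_
    filter_upwards [eventually_ge_atTop (0 : ℤ)] with i hi
    simp only [Function.comp_apply, twoSided, hi, if_true]
    rw [← zpow_natCast, Int.toNat_of_nonneg hi]
  · refine tendsto_const_nhds.congr' ?_
    filter_upwards [eventually_lt_atBot (0 : ℤ)] with i hi
    simp [twoSided, not_le.2 hi]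

/-- The restriction of functions from the disk `|T| ≤ p ^ (-n)` to the annulus
`p ^ (-n') ≤ |T| ≤ p ^ (-n)`. -/
def diskToAnnulus (n n' : ℕ) (h : n ≤ n') : Disk p L n →L[ℚ_[p]] Annulus p L n n' where
  toFun f := ⟨twoSided L f, twoSided_mem p L n n' f.2⟩
  map_add' f g := by
    ext i
    by_cases hi : 0 ≤ i <;> simp [twoSided, hi]
  map_smul' c f := by
    ext i
    by_cases hi : 0 ≤ i <;> simp [twoSided, hi]
  cont := by
    refine continuous_of_subgroupsBasis _ _ _ _
      (AddMonoidHom.mk' (fun f : Disk p L n => (⟨twoSided L f, twoSided_mem p L n n' f.2⟩ :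
        Annulus p L n n')) ?_) ?_
    · intro f g
      ext i
      by_cases hi : 0 ≤ i <;> simp [twoSided, hi]
    · intro ε
      refine ⟨ε, fun f hf i => ?_⟩
      change ‖twoSided L f i‖ * _ ≤ _ ∧ ‖twoSided L f i‖ * _ ≤ _
      by_cases hi : 0 ≤ i
      · lift i to ℕ using hi
        have h1 := hf i
        have h2 : radius p n' ^ i ≤ radius p n ^ i :=
          pow_le_pow_left₀ (radius_pos p n').le (radius_anti p h) i
        simp only [twoSided, Int.natCast_nonneg, if_true, Int.toNat_natCast, zpow_natCast]
        exact ⟨h1, (mul_le_mul_of_nonneg_left h2 (norm_nonneg _)).trans h1⟩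
      · simpa [twoSided, hi] using ε.2.le

end Affinoid

/-! ### The period rings -/

section Periods

variable (p : ℕ) [Fact p.Prime]

/-- `A_inf`, the Witt vectors of the tilt of `𝓞_ℂ_[p]`. -/
abbrev AInf : Type := WittVector p (PreTilt 𝓞_ℂ_[p] p)

/-- `A_inf[1/p]`. -/
abbrev AInfInv : Type := Localization.Away (p : AInf p)

/-- The kernel of Fontaine's map `θ : A_inf[1/p] → ℂ_p`. -/
abbrev kerTheta : Ideal (AInfInv p) := RingHom.ker (fontaineThetaInvertP 𝓞_ℂ_[p] p)

/-- `B_dR⁺`, the completion of `A_inf[1/p]` for the `ker θ`-adic topology. -/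
def BdRPlus : Type := BDeRhamPlus 𝓞_ℂ_[p] p

instance : CommRing (BdRPlus p) := inferInstanceAs (CommRing (BDeRhamPlus 𝓞_ℂ_[p] p))

instance : Algebra (AInfInv p) (BdRPlus p) :=
  inferInstanceAs (Algebra (AInfInv p) (AdicCompletion (kerTheta p) (AInfInv p)))

/-- The canonical map `ℤ_p = W(𝔽_p) → W(𝓞♭) = A_inf`. -/
def padicIntToAInf : ℤ_[p] →+* AInf p :=
  (WittVector.map (ZMod.castHom (dvd_refl p) (PreTilt 𝓞_ℂ_[p] p))).comp
    (WittVector.equiv p).symm.toRingHom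

theorem exists_pow_eq_mul (z : ℤ_[p]) (hz : z ≠ 0) : ∃ (n : ℕ) (u : ℤ_[p]), z * u = p ^ n :=
  ⟨z.valuation, ((PadicInt.unitCoeff hz)⁻¹ : ℤ_[p]ˣ), by
    nth_rewrite 1 [PadicInt.unitCoeff_spec hz]
    rw [mul_right_comm, Units.mul_inv, one_mul]⟩

theorem isUnit_p : IsUnit (p : AInfInv p) := by
  simpa using IsLocalization.Away.algebraMap_isUnit (S := AInfInv p) (p : AInf p)

theorem isUnit_padicInt (z : nonZeroDivisors ℤ_[p]) :
    IsUnit (((algebraMap (AInf p) (AInfInv p)).comp (padicIntToAInf p)) z) := by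
  obtain ⟨n, u, h⟩ := exists_pow_eq_mul p z (nonZeroDivisors.coe_ne_zero z)
  refine isUnit_of_mul_isUnit_left (y := ((algebraMap _ _).comp (padicIntToAInf p)) u) ?_
  rw [← map_mul, h, map_pow, map_natCast]
  exact (isUnit_p p).pow n

/-- The canonical map `ℚ_p → A_inf[1/p]`. -/
def padicToAInfInv : ℚ_[p] →+* AInfInv p :=
  IsLocalization.lift (M := nonZeroDivisors ℤ_[p]) (isUnit_padicInt p)

instance : Algebra ℚ_[p] (AInfInv p) := (padicToAInfInv p).toAlgebra

instance : Algebra ℚ_[p] (BdRPlus p) :=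
  inferInstanceAs (Algebra ℚ_[p] (AdicCompletion (kerTheta p) (AInfInv p)))

/-- The quotient `B_dR⁺ / (t ^ i) = A_inf[1/p] / (ker θ) ^ i`. -/
abbrev BdRQuot (i : ℕ) : Type := AInfInv p ⧸ kerTheta p ^ i

/-- The reduction map `B_dR⁺ → B_dR⁺ / (t ^ i)`. -/
def bdRReduction (i : ℕ) : BdRPlus p →ₐ[AInfInv p] BdRQuot p i :=
  AdicCompletion.evalₐ (kerTheta p) i

/-- The image of `A_inf` in `B_dR⁺ / (t ^ i)`. -/
def bdRLattice (i : ℕ) : AddSubgroup (BdRQuot p i) :=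
  ((Ideal.Quotient.mk (kerTheta p ^ i)).comp (algebraMap (AInf p) (AInfInv p))).range.toAddSubgroup

/-- The Fréchet topology of `B_dR⁺`, the inverse limit of the `p`-adic Banach spaces
`B_dR⁺ / (t ^ i)`, whose topology is given by the lattice which is the image of `A_inf`. -/
instance : TopologicalSpace (BdRPlus p) :=
  ⨅ i : ℕ, (latticeTopology p (bdRLattice p i)).induced (bdRReduction p i)

instance : IsTopologicalAddGroup (BdRPlus p) :=
  topologicalAddGroup_iInf fun i =>
    let _ : TopologicalSpace (BdRQuot p i) := latticeTopology p (bdRLattice p i)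
    have : IsTopologicalAddGroup (BdRQuot p i) := AddGroupFilterBasis.isTopologicalAddGroup _
    topologicalAddGroup_induced (bdRReduction p i)

/-- The `A_inf`-subalgebra of `A_inf[1/p]` generated by the divided powers `y ^ n / n!` of the
elements `y` of the kernel of `θ : A_inf → 𝓞_ℂ_[p]`, i.e. the divided power envelope of
`ker θ`. -/
def Acrys0 : Subalgebra (AInf p) (AInfInv p) :=
  Algebra.adjoin (AInf p) {w | ∃ y ∈ RingHom.ker (WittVector.fontaineTheta 𝓞_ℂ_[p] p), ∃ n : ℕ,
    (n.factorial : AInfInv p) * w = algebraMap (AInf p) (AInfInv p) y ^ n}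

/-- `A_crys`, the `p`-adic completion of `Acrys0`, realised inside `B_dR⁺` as the set of sums of
the series `∑ p ^ k y k` with `y k` in `Acrys0`. -/
def Acrys : AddSubgroup (BdRPlus p) where
  carrier := {x | ∃ y : ℕ → AInfInv p, (∀ k, y k ∈ Acrys0 p) ∧
    HasSum (fun k => algebraMap (AInfInv p) (BdRPlus p) (p ^ k * y k)) x}
  add_mem' := by
    rintro x x' ⟨y, hy, h⟩ ⟨y', hy', h'⟩
    refine ⟨y + y', fun k => add_mem (hy k) (hy' k), ?_⟩
    simpa only [Pi.add_apply, mul_add, map_add] using h.add h'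
  zero_mem' := ⟨0, fun k => zero_mem _, by simp⟩
  neg_mem' := by
    rintro x ⟨y, hy, h⟩
    refine ⟨-y, fun k => neg_mem (hy k), ?_⟩
    simpa only [Pi.neg_apply, mul_neg, map_neg] using h.neg

theorem continuous_to_bdR {G : Type*} [TopologicalSpace G] (f : G → BdRPlus p)
    (h : ∀ i, @Continuous G _ _ (latticeTopology p (bdRLattice p i))
      fun x => bdRReduction p i (f x)) :
    Continuous f :=
  continuous_iInf_rng.2 fun i => continuous_induced_rng.2 (h i)

theorem continuous_bdRReduction (i : ℕ) :
    @Continuous _ _ _ (latticeTopology p (bdRLattice p i)) (bdRReduction p i) :=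
  continuous_iInf_dom (i := i) continuous_induced_dom

theorem continuous_mul_aInf (a : AInf p) :
    Continuous fun x : BdRPlus p => algebraMap (AInfInv p) (BdRPlus p) (algebraMap _ _ a) * x := by
  refine continuous_to_bdR p _ fun i => ?_
  let _ : TopologicalSpace (BdRQuot p i) := latticeTopology p (bdRLattice p i)
  have h : Continuous fun x : BdRQuot p i =>
      Ideal.Quotient.mk (kerTheta p ^ i) (algebraMap _ _ a) * x := by
    refine continuous_of_subgroupsBasis _ _ _ _
      (AddMonoidHom.mulLeft (Ideal.Quotient.mk (kerTheta p ^ i) (algebraMap _ _ a))) fun n => ?_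
    refine ⟨n, ?_⟩
    rintro _ ⟨_, ⟨b, rfl⟩, rfl⟩
    refine ⟨_, ⟨a * b, rfl⟩, ?_⟩
    simp only [nsmulAddMonoidHom_apply, AddMonoidHom.coe_mulLeft, RingHom.coe_comp,
      Function.comp_apply, map_mul, mul_smul_comm]
  refine (h.comp (continuous_bdRReduction p i)).congr fun x => ?_
  rw [map_mul, AlgHom.commutes]
  rfl

theorem mul_mem_acrys (a : AInf p) {x : BdRPlus p} (hx : x ∈ Acrys p) :
    algebraMap (AInfInv p) (BdRPlus p) (algebraMap _ _ a) * x ∈ Acrys p := by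
  obtain ⟨y, hy, h⟩ := hx
  refine ⟨fun k => algebraMap _ _ a * y k,
    fun k => mul_mem (Subalgebra.algebraMap_mem _ a) (hy k), ?_⟩
  have := h.map (AddMonoidHom.mulLeft (algebraMap (AInfInv p) (BdRPlus p) (algebraMap _ _ a)))
    (continuous_mul_aInf p a)
  have h' : (fun k => algebraMap (AInfInv p) (BdRPlus p)
      (p ^ k * (algebraMap (AInf p) (AInfInv p) a * y k))) =
      (AddMonoidHom.mulLeft (algebraMap (AInfInv p) (BdRPlus p) (algebraMap _ _ a))) ∘
        fun k => algebraMap (AInfInv p) (BdRPlus p) (p ^ k * y k) := by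
    funext k
    simp only [Function.comp_apply, AddMonoidHom.coe_mulLeft]
    rw [← map_mul, mul_left_comm]
  rw [h']
  exact this

theorem isUnit_factorial (d : ℕ) : IsUnit (d.factorial : AInfInv p) := by
  have h : IsUnit (d.factorial : ℚ_[p]) :=
    IsUnit.mk0 _ (by exact_mod_cast d.factorial_ne_zero)
  simpa using h.map (algebraMap ℚ_[p] (AInfInv p))

theorem algebraMap_mem_kerTheta {y : AInf p}
    (hy : y ∈ RingHom.ker (WittVector.fontaineTheta 𝓞_ℂ_[p] p)) :
    algebraMap (AInf p) (AInfInv p) y ∈ kerTheta p := by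
  rw [RingHom.mem_ker] at hy ⊢
  rw [fontaineThetaInvertP, Localization.awayLift, IsLocalization.Away.lift_eq,
    RingHom.comp_apply, hy, map_zero]

/-- The elements `b / d!` of `A_inf[1/p]` with `b` in `(ker θ) ^ d`. -/
def dividedPower (d : ℕ) : Submodule (AInf p) (AInfInv p) where
  carrier := {w | ∃ b ∈ RingHom.ker (WittVector.fontaineTheta 𝓞_ℂ_[p] p) ^ d,
    (d.factorial : AInfInv p) * w = algebraMap (AInf p) (AInfInv p) b}
  add_mem' := by
    rintro w w' ⟨b, hb, h⟩ ⟨b', hb', h'⟩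
    exact ⟨b + b', add_mem hb hb', by rw [mul_add, h, h', map_add]⟩
  zero_mem' := ⟨0, zero_mem _, by simp⟩
  smul_mem' := by
    rintro c w ⟨b, hb, h⟩
    exact ⟨c * b, Ideal.mul_mem_left _ c hb, by
      rw [Algebra.smul_def, mul_left_comm, h, map_mul]⟩

theorem dividedPower_mul (d e : ℕ) :
    dividedPower p d * dividedPower p e ≤ dividedPower p (d + e) := by
  refine Submodule.mul_le.2 ?_
  rintro w ⟨b, hb, h⟩ w' ⟨b', hb', h'⟩
  obtain ⟨c, hc⟩ := Nat.factorial_mul_factorial_dvd_factorial_add d e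
  refine ⟨c * (b * b'), Ideal.mul_mem_left _ _ ?_, ?_⟩
  · rw [pow_add]
    exact Ideal.mul_mem_mul hb hb'
  rw [hc, map_mul, map_mul, ← h, ← h', map_natCast]
  push_cast
  ring

theorem acrys0_le {w : AInfInv p} (hw : w ∈ Acrys0 p) : w ∈ ⨆ d, dividedPower p d := by
  have h1 : (1 : AInfInv p) ∈ ⨆ d, dividedPower p d :=
    Submodule.mem_iSup_of_mem 0 ⟨1, by simp, by simp⟩
  have h2 : ∀ x y : AInfInv p, x ∈ ⨆ d, dividedPower p d → y ∈ ⨆ d, dividedPower p d →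
      x * y ∈ ⨆ d, dividedPower p d := by
    intro x y hx hy
    have h3 := Submodule.mul_mem_mul hx hy
    rw [Submodule.iSup_mul] at h3
    have h5 : ⨆ d, dividedPower p d * ⨆ e, dividedPower p e ≤ ⨆ d, dividedPower p d := by
      refine iSup_le fun d => ?_
      rw [Submodule.mul_iSup]
      exact iSup_le fun e => (dividedPower_mul p d e).trans (le_iSup (dividedPower p) (d + e))
    exact h5 h3
  have h4 : Acrys0 p ≤ (⨆ d, dividedPower p d).toSubalgebra h1 h2 := by
    refine Algebra.adjoin_le ?_
    rintro w ⟨y, hy, n, h⟩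
    exact Submodule.mem_iSup_of_mem n ⟨y ^ n, Ideal.pow_mem_pow hy n, by rw [h, map_pow]⟩
  exact h4 hw

theorem mul_mem_bdRLattice (i : ℕ) (a : AInf p) {x : BdRQuot p i} (hx : x ∈ bdRLattice p i) :
    Ideal.Quotient.mk (kerTheta p ^ i) (algebraMap _ _ a) * x ∈ bdRLattice p i := by
  obtain ⟨b, rfl⟩ := hx
  exact ⟨a * b, by simp only [map_mul]; rfl⟩

theorem factorial_mul_mem_bdRLattice (i : ℕ) {w : AInfInv p} (hw : w ∈ Acrys0 p) :
    Ideal.Quotient.mk (kerTheta p ^ i) (i.factorial * w) ∈ bdRLattice p i := by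
  refine Submodule.iSup_induction (dividedPower p)
    (motive := fun w => Ideal.Quotient.mk (kerTheta p ^ i) (i.factorial * w) ∈ bdRLattice p i)
    (acrys0_le p hw) ?_ ?_ ?_
  · rintro d w ⟨b, hb, h⟩
    rcases le_total d i with hd | hd
    · obtain ⟨c, hc⟩ := Nat.factorial_dvd_factorial hd
      refine ⟨c * b, ?_⟩
      rw [hc, Nat.cast_mul, mul_right_comm, h, RingHom.comp_apply, mul_comm _ b, map_mul,
        map_natCast]
    · have h1 : algebraMap (AInf p) (AInfInv p) b ∈ kerTheta p ^ d := by
        have h2 : (RingHom.ker (WittVector.fontaineTheta 𝓞_ℂ_[p] p)).map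
            (algebraMap (AInf p) (AInfInv p)) ≤ kerTheta p :=
          Ideal.map_le_iff_le_comap.2 fun y hy => algebraMap_mem_kerTheta p hy
        have h3 := Ideal.mem_map_of_mem (algebraMap (AInf p) (AInfInv p)) hb
        rw [Ideal.map_pow] at h3
        exact Ideal.pow_right_mono h2 d h3
      rw [← h] at h1
      have h4 := Ideal.pow_le_pow_right hd ((Ideal.unit_mul_mem_iff_mem _ (isUnit_factorial p d)).1 h1)
      rw [Ideal.Quotient.eq_zero_iff_mem.2 (Ideal.mul_mem_left _ _ h4)]
      exact zero_mem _
  · simp [zero_mem]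
  · intro x y hx hy
    rw [mul_add, map_add]
    exact add_mem hx hy

theorem exists_pow_mul_mem_bdRLattice (i : ℕ) : ∃ m : ℕ, ∀ w ∈ Acrys0 p,
    Ideal.Quotient.mk (kerTheta p ^ i) (p ^ m * w) ∈ bdRLattice p i := by
  obtain ⟨m, u, h⟩ := exists_pow_eq_mul p (i.factorial : ℤ_[p])
    (by exact_mod_cast i.factorial_ne_zero)
  refine ⟨m, fun w hw => ?_⟩
  have h1 := congrArg ((algebraMap (AInf p) (AInfInv p)).comp (padicIntToAInf p)) h
  rw [map_mul, map_pow, map_natCast, map_natCast, mul_comm] at h1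
  rw [← h1, mul_assoc, map_mul]
  exact mul_mem_bdRLattice p i _ (factorial_mul_mem_bdRLattice p i hw)

theorem exists_pow_smul_reduction_mem (i : ℕ) : ∃ m : ℕ, ∀ x ∈ Acrys p,
    p ^ m • bdRReduction p i x ∈ bdRLattice p i := by
  obtain ⟨m, hm⟩ := exists_pow_mul_mem_bdRLattice p i
  refine ⟨m, ?_⟩
  rintro x ⟨y, hy, h⟩
  let _ : TopologicalSpace (BdRQuot p i) := latticeTopology p (bdRLattice p i)
  have _ : IsTopologicalAddGroup (BdRQuot p i) := AddGroupFilterBasis.isTopologicalAddGroup _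
  have h1 := (h.map (bdRReduction p i) (continuous_bdRReduction p i)).const_smul (p ^ m)
  have hopen : IsOpen (bdRLattice p i : Set (BdRQuot p i)) := by
    refine AddSubgroup.isOpen_of_mem_nhds _ (g := 0) ?_
    refine (subgroupsBasis_hasBasis _ (latticeFamily_directed p (bdRLattice p i))).mem_iff.2
      ⟨0, trivial, ?_⟩
    rintro _ ⟨z, hz, rfl⟩
    simpa using hz
  have hclosed : IsClosed (bdRLattice p i : Set (BdRQuot p i)) :=
    AddSubgroup.isClosed_of_isOpen _ hopen
  refine hclosed.mem_of_tendsto h1 (Filter.Eventually.of_forall fun s => ?_)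
  refine sum_mem fun k _ => ?_
  have h2 := (bdRLattice p i).nsmul_mem (hm (y k) (hy k)) (p ^ k)
  convert h2 using 1
  simp only [Function.comp_apply, AlgHom.commutes, nsmul_eq_mul]
  change _ * Ideal.Quotient.mk (kerTheta p ^ i) _ = _
  simp only [map_mul, map_pow, map_natCast, Nat.cast_pow]
  ring

theorem padicInt_smul_mem_acrys (z : ℤ_[p]) {x : BdRPlus p} (hx : x ∈ Acrys p) :
    (z : ℚ_[p]) • x ∈ Acrys p := by
  have h : algebraMap ℚ_[p] (AInfInv p) z = algebraMap _ _ (padicIntToAInf p z) :=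
    IsLocalization.lift_eq (M := nonZeroDivisors ℤ_[p]) (isUnit_padicInt p) z
  have h' := mul_mem_acrys p (padicIntToAInf p z) hx
  rw [← h] at h'
  rw [Algebra.smul_def]
  exact h'

/-- `B_crys⁺ = A_crys[1/p]`, inside `B_dR⁺`. -/
def BcrysPlus : Submodule ℚ_[p] (BdRPlus p) where
  carrier := {x | ∃ k : ℕ, p ^ k • x ∈ Acrys p}
  add_mem' := by
    rintro x y ⟨k, hk⟩ ⟨l, hl⟩
    refine ⟨k + l, ?_⟩
    rw [smul_add]
    refine add_mem ?_ ?_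
    · rw [pow_add, mul_comm, mul_smul]
      exact (Acrys p).nsmul_mem hk _
    · rw [pow_add, mul_smul]
      exact (Acrys p).nsmul_mem hl _
  zero_mem' := ⟨0, by simp [zero_mem]⟩
  smul_mem' := by
    rintro c x ⟨k, hk⟩
    obtain ⟨n, z, hz⟩ : ∃ (n : ℕ) (z : ℤ_[p]), (p : ℚ_[p]) ^ n * c = z := by
      obtain ⟨⟨z, s⟩, h⟩ := IsLocalization.surj (nonZeroDivisors ℤ_[p]) c
      obtain ⟨n, u, hu⟩ := exists_pow_eq_mul p s (nonZeroDivisors.coe_ne_zero s)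
      refine ⟨n, z * u, ?_⟩
      have hu' := congrArg (algebraMap ℤ_[p] ℚ_[p]) hu
      have h' : c * algebraMap ℤ_[p] ℚ_[p] s = algebraMap ℤ_[p] ℚ_[p] z := h
      rw [map_mul, map_pow, map_natCast] at hu'
      rw [← hu', mul_right_comm, mul_comm _ c, h']
      exact (map_mul (algebraMap ℤ_[p] ℚ_[p]) z u).symm
    refine ⟨n + k, ?_⟩
    have h := padicInt_smul_mem_acrys p z hk
    rw [← hz] at h
    convert h using 1
    rw [← Nat.cast_smul_eq_nsmul ℚ_[p], ← Nat.cast_smul_eq_nsmul ℚ_[p], smul_smul, smul_smul]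
    congr 1
    push_cast
    ring

/-- The Banach topology of `B_crys⁺`, with unit ball `A_crys`. -/
instance : TopologicalSpace (BcrysPlus p) :=
  latticeTopology p ((Acrys p).comap (BcrysPlus p).subtype.toAddMonoidHom)

/-- The inclusion of `B_crys⁺` in `B_dR⁺`. -/
def bcrysToBdR : BcrysPlus p →L[ℚ_[p]] BdRPlus p where
  toLinearMap := (BcrysPlus p).subtype
  cont := by
    refine continuous_to_bdR p _ fun i => ?_
    refine continuous_of_subgroupsBasis _ _ _ _
      ((bdRReduction p i : BdRPlus p →+ BdRQuot p i).comp (BcrysPlus p).subtype.toAddMonoidHom)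
      fun n => ?_
    obtain ⟨m, hm⟩ := exists_pow_smul_reduction_mem p i
    refine ⟨n + m, ?_⟩
    rintro _ ⟨x, hx, rfl⟩
    refine ⟨_, hm _ hx, ?_⟩
    simp [pow_add, mul_assoc]

end Periods

end

end PadicPeriod

open PadicPeriod

/-!
The disk algebra is a topological direct summand of the annulus algebra: dropping the terms of
negative degree is a continuous projection `annulusToDisk` that splits the restriction map. By
functoriality, `S_M ⊗̂ W` is then a direct summand of `S_{M,M+1} ⊗̂ W`, compatibly with maps in `W`.
This gives the injectivity of `S_M ⊗̂ B_dR⁺ → S_{M,M+1} ⊗̂ B_dR⁺`, and also the intersection formula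
(`CompletedTensor.range_inf_range_of_leftInverse`): the projector onto the summand fixes an element
`x` of the intersection, and applied to a preimage of `x` in `S_{M,M+1} ⊗̂ B_crys⁺` it gives one
that comes from `S_M ⊗̂ B_crys⁺`.

It remains to prove that `S_{M,M+1} ⊗̂ B_crys⁺ → S_{M,M+1} ⊗̂ B_dR⁺` is injective. As `L` is finite
over `ℚ_[p]`, truncation of a series to degrees between `-N` and `N` has finite rank over `ℚ_[p]`;
the truncations are equicontinuous and converge pointwise to the identity, and they keep both
properties after `⊗̂ W`. Thus an element of `S_{M,M+1} ⊗̂ W` is determined by its coordinates in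
`ℚ_[p] ⊗̂ W`, and the problem is reduced to the injectivity of `ℚ_[p] ⊗̂ B_crys⁺ → ℚ_[p] ⊗̂ B_dR⁺`
(`CompletedTensor.map_id_injective`), that is, of the map between the completions of `B_crys⁺` and
`B_dR⁺`.

For this it suffices that a Cauchy sequence of `B_crys⁺` that tends to `0` in `B_dR⁺` tends to `0` in
`B_crys⁺` (`tendsto_zero_of_bcrysToBdR`). After passing to a subsequence, its `n`-th term is the sum
in `B_dR⁺` of the series of its successive differences, which lie in `p ^ m A_crys` for `m ≥ n`. Such
a sum is again in `p ^ n A_crys`: each difference is a series `∑ p ^ k y k` with `y k` in `Acrys0`,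
and since `A_crys` is bounded in `B_dR⁺` the double series may be rearranged by powers of `p`
(`mem_acrys_of_tendsto`). Neither the completeness nor the separatedness of the period rings is
needed.
-/

namespace PadicPeriod

noncomputable section

open Filter Topology UniformSpace
open scoped TensorProduct

/-! ### Completed tensor products: functoriality and approximation -/

section CompletedTensor

theorem ProjTensor.induction_on {p : ℕ} [Fact p.Prime] {V W : Type*} [AddCommGroup V]
    [Module ℚ_[p] V] [AddCommGroup W] [Module ℚ_[p] W] {motive : ProjTensor p V W → Prop}
    (x : ProjTensor p V W) (zero : motive 0)
    (tmul : ∀ v w, motive (v ⊗ₜ[ℚ_[p]] w : V ⊗[ℚ_[p]] W))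
    (add : ∀ x y, motive x → motive y → motive (x + y)) : motive x :=
  TensorProduct.induction_on x zero tmul add

variable (p : ℕ) [Fact p.Prime] {V W V' W' V'' W'' : Type*}
  [AddCommGroup V] [Module ℚ_[p] V] [TopologicalSpace V]
  [AddCommGroup W] [Module ℚ_[p] W] [TopologicalSpace W]
  [AddCommGroup V'] [Module ℚ_[p] V'] [TopologicalSpace V']
  [AddCommGroup W'] [Module ℚ_[p] W'] [TopologicalSpace W']
  [AddCommGroup V''] [Module ℚ_[p] V''] [TopologicalSpace V'']
  [AddCommGroup W''] [Module ℚ_[p] W''] [TopologicalSpace W'']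

theorem CompletedTensor.map_coe (f : V →L[ℚ_[p]] V') (g : W →L[ℚ_[p]] W')
    (x : ProjTensor p V W) :
    CompletedTensor.map p f g (x : CompletedTensor p V W) = projTensorMap p f g x :=
  AddMonoidHom.completion_coe _ (continuous_projTensorMap p f g) x

theorem CompletedTensor.continuous_map (f : V →L[ℚ_[p]] V') (g : W →L[ℚ_[p]] W') :
    Continuous (CompletedTensor.map p f g) :=
  AddMonoidHom.continuous_completion _ (continuous_projTensorMap p f g)

theorem CompletedTensor.map_map (f' : V' →L[ℚ_[p]] V'') (g' : W' →L[ℚ_[p]] W'')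
    (f : V →L[ℚ_[p]] V') (g : W →L[ℚ_[p]] W') (x : CompletedTensor p V W) :
    CompletedTensor.map p f' g' (CompletedTensor.map p f g x) =
      CompletedTensor.map p (f'.comp f) (g'.comp g) x := by
  induction x using Completion.induction_on with
  | hp =>
    exact isClosed_eq ((CompletedTensor.continuous_map p f' g').comp
      (CompletedTensor.continuous_map p f g)) (CompletedTensor.continuous_map p _ _)
  | ih x =>
    simp only [CompletedTensor.map_coe]
    congr 1
    induction x using ProjTensor.induction_on with
    | zero => simp only [map_zero]
    | tmul v w => rfl
    | add x y hx hy => simp only [map_add, hx, hy]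

theorem CompletedTensor.map_id (x : CompletedTensor p V W) :
    CompletedTensor.map p (.id ℚ_[p] V) (.id ℚ_[p] W) x = x := by
  induction x using Completion.induction_on with
  | hp => exact isClosed_eq (CompletedTensor.continuous_map p _ _) continuous_id
  | ih x =>
    rw [CompletedTensor.map_coe]
    congr 1
    exact LinearMap.congr_fun (TensorProduct.map_id (R := ℚ_[p]) (M := V) (N := W)) x

theorem CompletedTensor.map_sum_left [ContinuousAdd V'] {κ : Type*} (S : Finset κ)
    (f : κ → V →L[ℚ_[p]] V') (g : W →L[ℚ_[p]] W') (x : CompletedTensor p V W) :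
    CompletedTensor.map p (∑ s ∈ S, f s) g x = ∑ s ∈ S, CompletedTensor.map p (f s) g x := by
  induction x using Completion.induction_on with
  | hp =>
    exact isClosed_eq (CompletedTensor.continuous_map p _ _)
      (continuous_finsetSum _ fun s _ => CompletedTensor.continuous_map p _ _)
  | ih x =>
    simp only [CompletedTensor.map_coe]
    refine Eq.trans ?_ (map_sum Completion.toCompl _ S)
    refine congrArg Completion.toCompl ?_
    induction x using ProjTensor.induction_on with
    | zero => simp only [map_zero, Finset.sum_const_zero]
    | tmul v w =>
      change ((∑ s ∈ S, f s) v ⊗ₜ[ℚ_[p]] g w : V' ⊗[ℚ_[p]] W') =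
        ∑ s ∈ S, (f s v ⊗ₜ[ℚ_[p]] g w : V' ⊗[ℚ_[p]] W')
      rw [sum_apply, TensorProduct.sum_tmul]
    | add x y hx hy => simp only [map_add, hx, hy, Finset.sum_add_distrib]

theorem projTensor_hasBasis :
    (𝓝 (0 : ProjTensor p V W)).HasBasis (fun _ => True)
      (fun AB => (tensorFamily p V W AB : Set (ProjTensor p V W))) :=
  subgroupsBasis_hasBasis _ _

theorem completedTensor_hasBasis :
    (𝓝 (0 : CompletedTensor p V W)).HasBasis (fun _ => True)
      (fun AB => closure ((↑) '' (tensorFamily p V W AB : Set (ProjTensor p V W)))) :=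
  (projTensor_hasBasis (p := p) (V := V) (W := W)).hasBasis_of_isDenseInducing
    (Completion.isDenseInducing_coe (α := ProjTensor p V W))

/-- A pointwise convergent equicontinuous sequence of operators on `V` stays pointwise convergent
after the completed tensor product with `W`, if the open subgroups of `W` are absorbing. -/
theorem CompletedTensor.tendsto_map_left
    (hW : ∀ (w : W) (B : OpenAddSubgroup W), ∃ c : ℚ_[p], c ≠ 0 ∧ c • w ∈ B)
    (T : ℕ → V →L[ℚ_[p]] V)
    (hT : ∀ A : OpenAddSubgroup V, ∃ A' : OpenAddSubgroup V, ∀ n, ∀ v ∈ A', T n v ∈ A)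
    (hlim : ∀ (v : V) (A : OpenAddSubgroup V), ∀ᶠ n in atTop, T n v - v ∈ A)
    (x : CompletedTensor p V W) :
    Tendsto (fun n => CompletedTensor.map p (T n) (.id ℚ_[p] W) x) atTop (𝓝 x) := by
  have heq : Equicontinuous fun n => (CompletedTensor.map p (T n) (.id ℚ_[p] W) :
      CompletedTensor p V W → CompletedTensor p V W) := by
    refine equicontinuous_of_equicontinuousAt_zero
      (fun n => CompletedTensor.map p (T n) (.id ℚ_[p] W)) fun U hU => ?_
    rw [uniformity_eq_comap_nhds_zero] at hU
    obtain ⟨U', hU', hUU'⟩ := hU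
    obtain ⟨⟨A, B⟩, -, hAB⟩ := (completedTensor_hasBasis p).mem_iff.1 hU'
    obtain ⟨A', hA'⟩ := hT A
    filter_upwards [(completedTensor_hasBasis p).mem_of_mem (i := (A', B)) trivial] with y hy n
    refine hUU' ?_
    simp only [Function.comp_apply, Set.mem_preimage, map_zero, sub_zero]
    refine hAB (map_mem_closure (CompletedTensor.continuous_map p _ _) hy ?_)
    rintro _ ⟨z, hz, rfl⟩
    refine ⟨projTensorMap p (T n) (.id ℚ_[p] W) z, ?_, (CompletedTensor.map_coe p _ _ z).symm⟩
    have : tensorFamily p V W (A', B) ≤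
        (tensorFamily p V W (A, B)).comap (projTensorMap p (T n) (.id ℚ_[p] W)) := by
      refine (AddSubgroup.closure_le _).2 ?_
      rintro _ ⟨a, ha, b, hb, rfl⟩
      exact AddSubgroup.subset_closure ⟨T n a, hA' n a ha, b, hb, rfl⟩
    exact this hz
  have hcl := heq.isClosed_setOfPred_tendsto (l := atTop) (f := id) continuous_id
  induction x using Completion.induction_on with
  | hp => exact hcl
  | ih x =>
    simp only [CompletedTensor.map_coe]
    refine (Completion.continuous_coe _).continuousAt.tendsto.comp ?_
    induction x using ProjTensor.induction_on with
    | zero => simpa only [map_zero] using tendsto_const_nhds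
    | tmul v w =>
      refine tendsto_sub_nhds_zero_iff.1 ((projTensor_hasBasis p).tendsto_right_iff.2 ?_)
      rintro ⟨A, B⟩ -
      obtain ⟨c, hc, hcw⟩ := hW w B
      filter_upwards [hlim (c⁻¹ • v) A] with n hn
      refine AddSubgroup.subset_closure ⟨_, hn, _, hcw, ?_⟩
      change (T n v ⊗ₜ[ℚ_[p]] w - v ⊗ₜ[ℚ_[p]] w : V ⊗[ℚ_[p]] W) = _
      rw [← TensorProduct.sub_tmul, map_smul, ← smul_sub, TensorProduct.smul_tmul_smul,
        inv_mul_cancel₀ hc, one_smul]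
    | add x y hx hy =>
      simpa only [map_add] using hx.add hy

/-- If the identity of `V` is a pointwise limit of an equicontinuous sequence of operators of finite
rank, then `V ⊗̂ g` is injective as soon as `ℚ_[p] ⊗̂ g` is. -/
theorem CompletedTensor.map_id_injective [ContinuousAdd V] (g : W →L[ℚ_[p]] W')
    (hg : Function.Injective (CompletedTensor.map p (.id ℚ_[p] ℚ_[p]) g))
    (hW : ∀ (w : W) (B : OpenAddSubgroup W), ∃ c : ℚ_[p], c ≠ 0 ∧ c • w ∈ B)
    {κ : Type*} (S : ℕ → Finset κ) (ι : κ → ℚ_[p] →L[ℚ_[p]] V) (φ : κ → V →L[ℚ_[p]] ℚ_[p])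
    (hT : ∀ A : OpenAddSubgroup V, ∃ A' : OpenAddSubgroup V, ∀ n, ∀ v ∈ A',
      (∑ s ∈ S n, (ι s).comp (φ s)) v ∈ A)
    (hlim : ∀ (v : V) (A : OpenAddSubgroup V), ∀ᶠ n in atTop,
      (∑ s ∈ S n, (ι s).comp (φ s)) v - v ∈ A) :
    Function.Injective (CompletedTensor.map p (.id ℚ_[p] V) g) := by
  refine (injective_iff_map_eq_zero _).2 fun x hx => ?_
  have hφ : ∀ s, CompletedTensor.map p (φ s) (.id ℚ_[p] W) x = 0 := fun s => by
    refine (injective_iff_map_eq_zero _).1 hg _ ?_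
    have h := congrArg (CompletedTensor.map p (φ s) (.id ℚ_[p] W')) hx
    rw [map_zero, CompletedTensor.map_map] at h
    rw [CompletedTensor.map_map]
    exact h
  refine tendsto_nhds_unique (CompletedTensor.tendsto_map_left p hW _ hT hlim x)
    (tendsto_const_nhds.congr fun n => ?_)
  rw [CompletedTensor.map_sum_left]
  refine (Finset.sum_eq_zero fun s _ => ?_).symm
  have h := CompletedTensor.map_map p (ι s) (.id ℚ_[p] W) (φ s) (.id ℚ_[p] W) x
  rw [hφ, map_zero] at h
  exact h.symm

end CompletedTensor

/-! ### Images of a direct summand -/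

section Summand

variable (p : ℕ) [Fact p.Prime] {V W V' W' : Type*}
  [AddCommGroup V] [Module ℚ_[p] V] [TopologicalSpace V]
  [AddCommGroup W] [Module ℚ_[p] W] [TopologicalSpace W]
  [AddCommGroup V'] [Module ℚ_[p] V'] [TopologicalSpace V']
  [AddCommGroup W'] [Module ℚ_[p] W'] [TopologicalSpace W']

theorem CompletedTensor.map_left_leftInverse {ι : V →L[ℚ_[p]] V'} {π : V' →L[ℚ_[p]] V}
    (h : π.comp ι = .id ℚ_[p] V) :
    Function.LeftInverse (CompletedTensor.map p π (.id ℚ_[p] W))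
      (CompletedTensor.map p ι (.id ℚ_[p] W)) := fun x => by
  rw [CompletedTensor.map_map, h]
  exact CompletedTensor.map_id p x

theorem CompletedTensor.map_injective_of_leftInverse {ι : V →L[ℚ_[p]] V'} {π : V' →L[ℚ_[p]] V}
    (h : π.comp ι = .id ℚ_[p] V) {g : W →L[ℚ_[p]] W'}
    (hg : Function.Injective (CompletedTensor.map p (.id ℚ_[p] V') g)) :
    Function.Injective (CompletedTensor.map p ι g) := by
  have hcomp : ∀ x, CompletedTensor.map p ι g x =
      CompletedTensor.map p (.id ℚ_[p] V') g (CompletedTensor.map p ι (.id ℚ_[p] W) x) :=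
    fun x => (CompletedTensor.map_map p (.id ℚ_[p] V') g ι (.id ℚ_[p] W) x).symm
  intro x y hxy
  rw [hcomp, hcomp] at hxy
  exact (CompletedTensor.map_left_leftInverse p h).injective (hg hxy)

/-- If `V` is a direct summand of `V'`, an element of `V' ⊗̂ W'` that comes both from `V ⊗̂ W'` and
from `V' ⊗̂ W` comes from `V ⊗̂ W`. -/
theorem CompletedTensor.range_inf_range_of_leftInverse {ι : V →L[ℚ_[p]] V'}
    {π : V' →L[ℚ_[p]] V} (h : π.comp ι = .id ℚ_[p] V) (g : W →L[ℚ_[p]] W') :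
    (CompletedTensor.map p ι (.id ℚ_[p] W')).range ⊓
      (CompletedTensor.map p (.id ℚ_[p] V') g).range = (CompletedTensor.map p ι g).range := by
  refine le_antisymm ?_ ?_
  · rintro _ ⟨⟨a, rfl⟩, b, hb⟩
    -- The projector `ι ∘ π` fixes the image of `a` and commutes with `id ⊗ g`.
    refine ⟨CompletedTensor.map p π (.id ℚ_[p] W) b, ?_⟩
    have h1 := congrArg (CompletedTensor.map p (ι.comp π) (.id ℚ_[p] W')) hb
    rw [CompletedTensor.map_map, CompletedTensor.map_map, ContinuousLinearMap.comp_assoc ι π ι,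
      h] at h1
    rw [CompletedTensor.map_map]
    exact h1
  · rintro _ ⟨x, rfl⟩
    exact ⟨⟨_, CompletedTensor.map_map p ι (.id ℚ_[p] W') (.id ℚ_[p] V) g x⟩,
      _, CompletedTensor.map_map p (.id ℚ_[p] V') g ι (.id ℚ_[p] W) x⟩

end Summand

/-! ### The annulus algebra: the disk as a direct summand, and approximation by finite rank -/

section Affinoid

variable (p : ℕ) [Fact p.Prime] (L : Type*) [NormedField L] [NormedAlgebra ℚ_[p] L] (n n' : ℕ)

instance : IsTopologicalAddGroup (Annulus p L n n') :=
  (subgroupsBasis (annulusBall p L n n') (annulusBall_directed p L n n')).isTopologicalAddGroup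

theorem annulus_hasBasis : (𝓝 (0 : Annulus p L n n')).HasBasis (fun _ => True)
    (fun ε => (annulusBall p L n n' ε : Set (Annulus p L n n'))) :=
  subgroupsBasis_hasBasis _ _

theorem exists_annulusBall_subset (A : OpenAddSubgroup (Annulus p L n n')) :
    ∃ ε, ∀ a ∈ annulusBall p L n n' ε, a ∈ A := by
  obtain ⟨ε, -, h⟩ := (annulus_hasBasis p L n n').mem_iff.1 (A.isOpen.mem_nhds A.zero_mem)
  exact ⟨ε, h⟩

theorem isOpen_annulusBall (ε : {ε : ℝ // 0 < ε}) :
    IsOpen (annulusBall p L n n' ε : Set (Annulus p L n n')) :=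
  AddSubgroup.isOpen_of_mem_nhds _ ((annulus_hasBasis p L n n').mem_of_mem (i := ε) trivial)

/-- The projection from functions on the annulus to functions on the disk that drops the terms of
negative degree. -/
def annulusToDisk : Annulus p L n n' →L[ℚ_[p]] Disk p L n where
  toFun a := ⟨PowerSeries.mk fun i => (a : ℤ → L) i, by
    refine (PowerSeries.isRestricted_iff' _ _).2 ?_
    simpa [Function.comp_def] using a.2.1.comp tendsto_natCast_atTop_atTop⟩
  map_add' a b := by ext; simp
  map_smul' c a := by
    ext i
    change _ = c • PowerSeries.coeff i (PowerSeries.mk fun i : ℕ => (a : ℤ → L) i)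
    simp
  cont := by
    refine continuous_of_subgroupsBasis _ _ _ _
      (AddMonoidHom.mk' (fun a : Annulus p L n n' => (⟨PowerSeries.mk fun i => (a : ℤ → L) i, _⟩ :
        Disk p L n)) fun a b => by ext; simp) fun ε => ⟨ε, fun a ha i => ?_⟩
    simpa using (ha i).1

theorem annulusToDisk_comp_diskToAnnulus (h : n ≤ n') :
    (annulusToDisk p L n n').comp (diskToAnnulus p L n n' h) = .id ℚ_[p] (Disk p L n) := by
  ext f i
  change PowerSeries.coeff i (PowerSeries.mk fun i : ℕ => twoSided L f i) = _
  simp [twoSided]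

variable {L}

/-- The coefficient of `T ^ i` of a function on the annulus. -/
def annulusCoeff (i : ℤ) : Annulus p L n n' →L[ℚ_[p]] L where
  toFun a := (a : ℤ → L) i
  map_add' _ _ := rfl
  map_smul' _ _ := rfl
  cont := by
    refine continuous_of_continuousAt_zero
      (AddMonoidHom.mk' (fun a : Annulus p L n n' => (a : ℤ → L) i) fun _ _ => rfl) ?_
    rw [ContinuousAt, map_zero, (annulus_hasBasis p L n n').tendsto_iff Metric.nhds_basis_closedBall]
    intro ε hε
    have hr := zpow_pos (radius_pos p n) i
    refine ⟨⟨ε * radius p n ^ i, mul_pos hε hr⟩, trivial, fun a ha => ?_⟩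
    rw [mem_closedBall_zero_iff]
    exact le_of_mul_le_mul_right (ha i).1 hr

theorem single_mem_annulus (i : ℤ) (x : L) : Pi.single i x ∈ Annulus p L n n' := by
  constructor
  · refine tendsto_const_nhds.congr' ?_
    filter_upwards [eventually_gt_atTop i] with j hj
    simp [hj.ne']
  · refine tendsto_const_nhds.congr' ?_
    filter_upwards [eventually_lt_atBot i] with j hj
    simp [hj.ne]

/-- The function `x T ^ i` on the annulus. -/
def annulusMonomial (i : ℤ) : L →L[ℚ_[p]] Annulus p L n n' where
  toFun x := ⟨Pi.single i x, single_mem_annulus p n n' i x⟩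
  map_add' x y := Subtype.ext (Pi.single_add (f := fun _ : ℤ => L) i x y)
  map_smul' c x := Subtype.ext (Pi.single_smul (f := fun _ : ℤ => L) i c x)
  cont := by
    refine continuous_of_continuousAt_zero (AddMonoidHom.mk' (fun x : L =>
      (⟨Pi.single i x, single_mem_annulus p n n' i x⟩ : Annulus p L n n'))
      fun x y => Subtype.ext (Pi.single_add (f := fun _ : ℤ => L) i x y)) ?_
    rw [ContinuousAt, map_zero, Metric.nhds_basis_closedBall.tendsto_iff (annulus_hasBasis p L n n')]
    intro ε _
    have hr := zpow_pos (radius_pos p n) i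
    have hr' := zpow_pos (radius_pos p n') i
    refine ⟨min (ε / radius p n ^ i) (ε / radius p n' ^ i),
      lt_min (div_pos ε.2 hr) (div_pos ε.2 hr'), fun x hx j => ?_⟩
    rw [mem_closedBall_zero_iff, le_min_iff, le_div_iff₀ hr, le_div_iff₀ hr'] at hx
    change ‖(Pi.single i x : ℤ → L) j‖ * _ ≤ _ ∧ ‖(Pi.single i x : ℤ → L) j‖ * _ ≤ _
    rcases eq_or_ne j i with rfl | hj
    · simpa using hx
    · simpa [hj] using ε.2.le

theorem annulusMonomial_apply (i : ℤ) (x : L) (j : ℤ) :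
    (annulusMonomial p n n' i x : ℤ → L) j = (Pi.single i x : ℤ → L) j :=
  rfl

variable (L) [FiniteDimensional ℚ_[p] L]

/-- The functional that takes a coordinate, in a basis of `L` over `ℚ_[p]`, of the coefficient of
`T ^ i`. -/
def annulusCoord (s : ℤ × Fin (Module.finrank ℚ_[p] L)) : Annulus p L n n' →L[ℚ_[p]] ℚ_[p] :=
  (LinearMap.toContinuousLinearMap ((Module.finBasis ℚ_[p] L).coord s.2)).comp
    (annulusCoeff p n n' s.1)

/-- The line spanned by `b T ^ i`, for `b` in a basis of `L` over `ℚ_[p]`. -/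
def annulusLine (s : ℤ × Fin (Module.finrank ℚ_[p] L)) : ℚ_[p] →L[ℚ_[p]] Annulus p L n n' :=
  (annulusMonomial p n n' s.1).comp
    (ContinuousLinearMap.toSpanSingleton ℚ_[p] (Module.finBasis ℚ_[p] L s.2))

/-- The sum over `b` of the operators of rank one attached to `b T ^ i`, for `|i| ≤ N`, is truncation
to the degrees between `-N` and `N`. -/
theorem annulus_truncation_apply (N : ℕ) (a : Annulus p L n n') (j : ℤ) :
    (((∑ s ∈ Finset.Icc (-(N : ℤ)) N ×ˢ Finset.univ,
      (annulusLine p L n n' s).comp (annulusCoord p L n n' s)) a : Annulus p L n n') : ℤ → L) j =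
      if j ∈ Finset.Icc (-(N : ℤ)) N then (a : ℤ → L) j else 0 := by
  have key : ∀ i, ∑ k, (annulusLine p L n n' (i, k)) (annulusCoord p L n n' (i, k) a) =
      annulusMonomial p n n' i ((a : ℤ → L) i) := fun i => by
    conv_rhs => rw [← (Module.finBasis ℚ_[p] L).sum_repr ((a : ℤ → L) i), map_sum]
    simp only [annulusLine, annulusCoord, ContinuousLinearMap.comp_apply]
    rfl
  rw [sum_apply, Finset.sum_product]
  simp only [ContinuousLinearMap.comp_apply, key]
  rw [Submodule.coe_sum, Finset.sum_apply]
  simp [Pi.single_apply, annulusMonomial_apply]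

theorem annulus_truncation_mem (N : ℕ) (ε : {ε : ℝ // 0 < ε}) {a : Annulus p L n n'}
    (ha : a ∈ annulusBall p L n n' ε) :
    (∑ s ∈ Finset.Icc (-(N : ℤ)) N ×ˢ Finset.univ,
      (annulusLine p L n n' s).comp (annulusCoord p L n n' s)) a ∈ annulusBall p L n n' ε := by
  intro j
  rw [annulus_truncation_apply]
  split_ifs
  · exact ha j
  · simpa using ε.2.le

theorem annulus_truncation_sub_mem (h : n ≤ n') (a : Annulus p L n n') (ε : {ε : ℝ // 0 < ε}) :
    ∀ᶠ N : ℕ in atTop, (∑ s ∈ Finset.Icc (-(N : ℤ)) N ×ˢ Finset.univ,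
      (annulusLine p L n n' s).comp (annulusCoord p L n n' s)) a - a ∈ annulusBall p L n n' ε := by
  obtain ⟨i₁, h₁⟩ := eventually_atTop.1 (a.2.1.eventually (ge_mem_nhds ε.2))
  obtain ⟨i₂, h₂⟩ := eventually_atBot.1 (a.2.2.eventually (ge_mem_nhds ε.2))
  filter_upwards [eventually_ge_atTop (i₁.natAbs + i₂.natAbs)] with N hN j
  have hsub : (((∑ s ∈ Finset.Icc (-(N : ℤ)) N ×ˢ Finset.univ,
      (annulusLine p L n n' s).comp (annulusCoord p L n n' s)) a - a : Annulus p L n n') : ℤ → L) j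
      = (if j ∈ Finset.Icc (-(N : ℤ)) N then (a : ℤ → L) j else 0) - (a : ℤ → L) j := by
    rw [← annulus_truncation_apply p L n n' N a j]
    rfl
  rw [hsub]
  have hrr := radius_anti p h
  split_ifs with hj
  · simpa using ε.2.le
  rw [zero_sub, norm_neg]
  rw [Finset.mem_Icc, not_and_or] at hj
  -- The larger of the two weights is the one at `n` in degrees `≥ 0` and at `n'` in degrees `≤ 0`.
  rcases le_total 0 j with hj0 | hj0
  · have h3 := h₁ j (by omega)
    refine ⟨h3, (mul_le_mul_of_nonneg_left ?_ (norm_nonneg _)).trans h3⟩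
    lift j to ℕ using hj0
    simpa using pow_le_pow_left₀ (radius_pos p n').le hrr j
  · have h3 := h₂ j (by omega)
    refine ⟨(mul_le_mul_of_nonneg_left ?_ (norm_nonneg _)).trans h3, h3⟩
    obtain ⟨k, rfl⟩ := Int.exists_eq_neg_ofNat hj0
    rw [zpow_neg, zpow_neg, zpow_natCast, zpow_natCast]
    exact inv_anti₀ (pow_pos (radius_pos p n') k) (pow_le_pow_left₀ (radius_pos p n').le hrr k)

/-- An element of `S ⊗̂ W`, for `S` an annulus algebra, is determined by its coordinates in
`ℚ_[p] ⊗̂ W`, so that injectivity of `S ⊗̂ g` follows from that of `ℚ_[p] ⊗̂ g`. -/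
theorem CompletedTensor.map_id_annulus_injective (h : n ≤ n') {W W' : Type*}
    [AddCommGroup W] [Module ℚ_[p] W] [TopologicalSpace W]
    [AddCommGroup W'] [Module ℚ_[p] W'] [TopologicalSpace W'] (g : W →L[ℚ_[p]] W')
    (hg : Function.Injective (CompletedTensor.map p (.id ℚ_[p] ℚ_[p]) g))
    (hW : ∀ (w : W) (B : OpenAddSubgroup W), ∃ c : ℚ_[p], c ≠ 0 ∧ c • w ∈ B) :
    Function.Injective (CompletedTensor.map p (.id ℚ_[p] (Annulus p L n n')) g) := by
  refine CompletedTensor.map_id_injective p g hg hW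
    (fun N : ℕ => Finset.Icc (-(N : ℤ)) N ×ˢ Finset.univ) (annulusLine p L n n')
    (annulusCoord p L n n') (fun A => ?_) fun a A => ?_
  · obtain ⟨ε, hε⟩ := exists_annulusBall_subset p L n n' A
    exact ⟨⟨annulusBall p L n n' ε, isOpen_annulusBall p L n n' ε⟩, fun N a ha =>
      hε _ (annulus_truncation_mem p L n n' N ε ha)⟩
  · obtain ⟨ε, hε⟩ := exists_annulusBall_subset p L n n' A
    exact (annulus_truncation_sub_mem p L n n' h a ε).mono fun N hN => hε _ hN

end Affinoid

/-! ### Injectivity of a map of completions -/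

/-- The map of completions induced by `f : G → H`, with `G` first countable, is injective if every
Cauchy sequence of `G` whose image tends to `0` tends to `0`. -/
theorem completion_injective_of_cauchySeq {G H : Type*} [AddCommGroup G] [UniformSpace G]
    [IsUniformAddGroup G] [(𝓝 (0 : G)).IsCountablyGenerated] [AddCommGroup H] [UniformSpace H]
    [IsUniformAddGroup H] (f : G →+ H) (hf : Continuous f)
    (h : ∀ g : ℕ → G, CauchySeq g → Tendsto (fun k => f (g k)) atTop (𝓝 0) →
      Tendsto g atTop (𝓝 0)) :
    Function.Injective (f.completion hf) := by
  refine (injective_iff_map_eq_zero _).2 fun x hx => ?_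
  have : (𝓝 (0 : Completion G)).IsCountablyGenerated := by
    obtain ⟨s, hs⟩ := (𝓝 (0 : G)).exists_antitone_basis
    have h0 := hs.1.hasBasis_of_isDenseInducing (Completion.isDenseInducing_coe (α := G))
    exact h0.isCountablyGenerated
  have : (uniformity (Completion G)).IsCountablyGenerated :=
    IsUniformAddGroup.uniformity_countably_generated
  obtain ⟨y, hy, hyx⟩ := mem_closure_iff_seq_limit.1
    (Completion.denseRange_coe (α := G) x)
  choose g hg using hy
  obtain rfl : (fun k => (g k : Completion G)) = y := funext hg
  have hcauchy : CauchySeq g :=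
    by
    rw [CauchySeq, ← (Completion.isUniformInducing_coe G).cauchy_map_iff, map_map]
    exact hyx.cauchySeq
  have h0 : Tendsto (fun k => f (g k)) atTop (𝓝 0) := by
    rw [(Completion.isUniformInducing_coe H).isInducing.tendsto_nhds_iff]
    have h1 := ((f.continuous_completion hf).tendsto x).comp hyx
    rw [hx] at h1
    exact h1.congr fun k => f.completion_coe hf (g k)
  exact tendsto_nhds_unique hyx ((Completion.continuous_coe G).continuousAt.tendsto.comp
    (h g hcauchy h0))

section Lid

variable (p : ℕ) [Fact p.Prime]

/-- The closed unit ball of `ℚ_[p]`, as an open subgroup. -/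
def padicUnitBall : OpenAddSubgroup ℚ_[p] where
  toAddSubgroup := (PadicInt.subring p).toAddSubgroup
  isOpen' := by
    convert IsUltrametricDist.isOpen_closedBall (0 : ℚ_[p]) one_ne_zero using 1
    ext x
    rw [mem_closedBall_zero_iff]
    rfl

variable (W : Type*) [AddCommGroup W] [Module ℚ_[p] W]

/-- The canonical map `ℚ_[p] ⊗ W → W`. -/
def projTensorLid : ProjTensor p ℚ_[p] W →+ W := (TensorProduct.lid ℚ_[p] W).toAddMonoidHom

/-- The canonical map `W → ℚ_[p] ⊗ W`. -/
def projTensorLidInv : W →+ ProjTensor p ℚ_[p] W :=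
  (TensorProduct.lid ℚ_[p] W).symm.toAddMonoidHom

variable {W}

theorem projTensorLidInv_lid (x : ProjTensor p ℚ_[p] W) :
    projTensorLidInv p W (projTensorLid p W x) = x :=
  (TensorProduct.lid ℚ_[p] W).symm_apply_apply x

variable [TopologicalSpace W]

/-- Continuity of `ℚ_[p] ⊗ W → W` at the open subgroups of `W` that are `ℤ_[p]`-submodules. -/
theorem projTensorLid_mem (B : OpenAddSubgroup W)
    (hB : ∀ c : ℤ_[p], ∀ w ∈ B, (c : ℚ_[p]) • w ∈ B) {x : ProjTensor p ℚ_[p] W}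
    (hx : x ∈ tensorFamily p ℚ_[p] W (padicUnitBall p, B)) : projTensorLid p W x ∈ B := by
  have : tensorFamily p ℚ_[p] W (padicUnitBall p, B) ≤
      (B : AddSubgroup W).comap (projTensorLid p W) := by
    refine (AddSubgroup.closure_le _).2 ?_
    rintro _ ⟨a, ha, b, hb, rfl⟩
    change TensorProduct.lid ℚ_[p] W (a ⊗ₜ b) ∈ B
    rw [TensorProduct.lid_tmul]
    exact hB ⟨a, ha⟩ b hb
  exact this hx

theorem projTensorLid_map {W' : Type*} [AddCommGroup W'] [Module ℚ_[p] W'] [TopologicalSpace W']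
    (g : W →L[ℚ_[p]] W') (x : ProjTensor p ℚ_[p] W) :
    projTensorLid p W' (projTensorMap p (.id ℚ_[p] ℚ_[p]) g x) = g (projTensorLid p W x) := by
  induction x using ProjTensor.induction_on with
  | zero => simp only [map_zero]
  | tmul c w =>
    change TensorProduct.lid ℚ_[p] W' (c ⊗ₜ g w) = g (TensorProduct.lid ℚ_[p] W (c ⊗ₜ w))
    simp
  | add x y hx hy => simp only [map_add, hx, hy]

/-- Since `ℚ_[p] ⊗̂ W` is the completion of `W`, the map `ℚ_[p] ⊗̂ g` is injective if `g` is injective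
on completions. -/
theorem CompletedTensor.map_id_padic_injective {W W' : Type*} [AddCommGroup W] [Module ℚ_[p] W]
    [UniformSpace W] [IsUniformAddGroup W] [AddCommGroup W'] [Module ℚ_[p] W'] [UniformSpace W']
    [IsUniformAddGroup W'] (g : W →L[ℚ_[p]] W')
    (hl : Continuous (projTensorLid p W)) (hs : Continuous (projTensorLidInv p W))
    (hl' : Continuous (projTensorLid p W'))
    (hg : Function.Injective ((g : W →+ W').completion g.continuous)) :
    Function.Injective (CompletedTensor.map p (.id ℚ_[p] ℚ_[p]) g) := by
  refine (injective_iff_map_eq_zero _).2 fun x hx => ?_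
  have h1 : ((g : W →+ W').completion g.continuous) ((projTensorLid p W).completion hl x) =
      (projTensorLid p W').completion hl' (CompletedTensor.map p (.id ℚ_[p] ℚ_[p]) g x) := by
    clear hx
    induction x using Completion.induction_on with
    | hp =>
      exact isClosed_eq
        ((AddMonoidHom.continuous_completion _ _).comp (AddMonoidHom.continuous_completion _ _))
        ((AddMonoidHom.continuous_completion _ _).comp (CompletedTensor.continuous_map p _ _))
    | ih x =>
      rw [CompletedTensor.map_coe, AddMonoidHom.completion_coe, AddMonoidHom.completion_coe,
        projTensorLid_map]
      exact AddMonoidHom.completion_coe (g : W →+ W') g.continuous _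
  have h2 : (projTensorLidInv p W).completion hs ((projTensorLid p W).completion hl x) = x := by
    clear hx h1
    induction x using Completion.induction_on with
    | hp =>
      exact isClosed_eq ((AddMonoidHom.continuous_completion _ _).comp
        (AddMonoidHom.continuous_completion _ _)) continuous_id
    | ih x => simp only [AddMonoidHom.completion_coe, projTensorLidInv_lid]
  rw [hx, map_zero] at h1
  rw [← h2, (injective_iff_map_eq_zero _).1 hg _ h1, map_zero]

end Lid

/-! ### The period rings -/

section Periods

variable (p : ℕ) [Fact p.Prime]

/-- Convergence in `B_dR⁺` is tested by its open subgroups. -/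
theorem tendsto_bdR {α : Type*} {l : Filter α} {F : α → BdRPlus p} {x : BdRPlus p}
    (h : ∀ U : OpenAddSubgroup (BdRPlus p), ∀ᶠ a in l, F a - x ∈ U) : Tendsto F l (𝓝 x) := by
  refine tendsto_sub_nhds_zero_iff.1 ?_
  rw [nhds_iInf, tendsto_iInf]
  intro i
  let _ : TopologicalSpace (BdRQuot p i) := latticeTopology p (bdRLattice p i)
  have _ : IsTopologicalAddGroup (BdRQuot p i) := AddGroupFilterBasis.isTopologicalAddGroup _
  have hb := subgroupsBasis_hasBasis _ (latticeFamily_directed p (bdRLattice p i))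
  rw [nhds_induced, tendsto_comap_iff, map_zero, hb.tendsto_right_iff]
  intro n _
  have hn : IsOpen (latticeFamily p (bdRLattice p i) n : Set (BdRQuot p i)) :=
    AddSubgroup.isOpen_of_mem_nhds _ (hb.mem_of_mem trivial)
  exact h ((⟨_, hn⟩ : OpenAddSubgroup (BdRQuot p i)).comap
    (bdRReduction p i : BdRPlus p →+ BdRQuot p i) (continuous_bdRReduction p i))

/-- `A_crys` is a bounded subset of `B_dR⁺`. -/
theorem exists_pow_smul_acrys_mem (U : OpenAddSubgroup (BdRPlus p)) :
    ∃ N, ∀ n ≥ N, ∀ z ∈ Acrys p, p ^ n • z ∈ U := by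
  have h := (bcrysToBdR p).continuous.tendsto 0
  rw [map_zero] at h
  obtain ⟨N, -, hN⟩ := (subgroupsBasis_hasBasis _ (latticeFamily_directed p
    ((Acrys p).comap (BcrysPlus p).subtype.toAddMonoidHom))).mem_iff.1
    (h (U.isOpen.mem_nhds U.zero_mem))
  refine ⟨N, fun n hn z hz => ?_⟩
  obtain ⟨k, rfl⟩ := Nat.exists_eq_add_of_le hn
  have hz' : p ^ k • z ∈ Acrys p := (Acrys p).nsmul_mem hz _
  have h1 : (p ^ N • (⟨p ^ k • z, 0, by simpa using hz'⟩ : BcrysPlus p)) ∈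
      (bcrysToBdR p) ⁻¹' (U : Set (BdRPlus p)) := hN ⟨⟨p ^ k • z, 0, by simpa using hz'⟩, hz', rfl⟩
  rw [pow_add, mul_smul]
  exact h1

theorem acrys0_subset_acrys {w : AInfInv p} (hw : w ∈ Acrys0 p) :
    algebraMap (AInfInv p) (BdRPlus p) w ∈ Acrys p := by
  refine ⟨Pi.single 0 w, fun k => ?_, ?_⟩
  · rcases eq_or_ne k 0 with rfl | hk
    · simpa using hw
    · simp [hk]
  · convert hasSum_single (α := BdRPlus p) 0 fun k hk => ?_
    · simp
    · simp [hk]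

/-- `A_crys` contains the limits in `B_dR⁺` of the series `∑ p ^ m z m` with terms `z m` in
`A_crys`. -/
theorem mem_acrys_of_tendsto {z : ℕ → BdRPlus p} (hz : ∀ m, z m ∈ Acrys p) {x : BdRPlus p}
    (hx : Tendsto (fun N => ∑ m ∈ Finset.range N, p ^ m • z m) atTop (𝓝 x)) : x ∈ Acrys p := by
  choose y hy hyz using hz
  have hterm : ∀ (n : ℕ) (w : AInfInv p), algebraMap (AInfInv p) (BdRPlus p) (p ^ n * w) =
      p ^ n • algebraMap (AInfInv p) (BdRPlus p) w := fun n w => by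
    simp [nsmul_eq_mul]
  simp only [hterm] at hyz
  -- Collect the double series `∑ p ^ (m + k) y m k` by the exponent of `p`.
  refine ⟨fun l => ∑ q ∈ Finset.HasAntidiagonal.antidiagonal l, y q.1 q.2,
    fun l => sum_mem fun q _ => hy _ _, tendsto_bdR p fun U => ?_⟩
  obtain ⟨N, hN⟩ := exists_pow_smul_acrys_mem p U
  have hUc : IsClosed (U : Set (BdRPlus p)) := U.isClosed
  set a : ℕ → ℕ → BdRPlus p := fun m k => algebraMap (AInfInv p) (BdRPlus p) (y m k)
  have ha : ∀ m k, a m k ∈ Acrys p := fun m k => acrys0_subset_acrys p (hy m k)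
  have hz : ∀ m, z m ∈ Acrys p := fun m => ⟨y m, hy m, by simpa only [hterm] using hyz m⟩
  have hxN : ∑ m ∈ Finset.range N, p ^ m • z m - x ∈ U := by
    refine hUc.mem_of_tendsto (tendsto_const_nhds.sub hx) ?_
    filter_upwards [eventually_ge_atTop N] with N' hN'
    rw [← neg_sub, ← Finset.sum_Ico_eq_sub _ hN']
    exact neg_mem (sum_mem fun m hm => hN m (Finset.mem_Ico.1 hm).1 _ (hz m))
  have hzN : ∀ m, ∑ k ∈ Finset.range (N - m), p ^ (m + k) • a m k - p ^ m • z m ∈ U := fun m => by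
    refine hUc.mem_of_tendsto
      (tendsto_const_nhds.sub ((hyz m).tendsto_sum_nat.const_smul (p ^ m))) ?_
    filter_upwards [eventually_ge_atTop (N - m)] with N' hN'
    simp only [Finset.smul_sum, smul_smul, ← pow_add]
    rw [← neg_sub, ← Finset.sum_Ico_eq_sub _ hN']
    refine neg_mem (sum_mem fun k hk => hN _ ?_ _ (ha m k))
    have := (Finset.mem_Ico.1 hk).1
    omega
  have hdiag : ∑ l ∈ Finset.range N, p ^ l • ∑ q ∈ Finset.HasAntidiagonal.antidiagonal l, a q.1 q.2
      = ∑ m ∈ Finset.range N, ∑ k ∈ Finset.range (N - m), p ^ (m + k) • a m k := by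
    rw [← Finset.sum_range_diag_flip]
    refine Finset.sum_congr rfl fun l _ => ?_
    rw [Finset.Nat.sum_antidiagonal_eq_sum_range_succ_mk, Finset.smul_sum]
    refine Finset.sum_congr rfl fun k hk => ?_
    have := Finset.mem_range.1 hk
    rw [show k + (l - k) = l by omega]
  filter_upwards [eventually_ge_atTop (Finset.range N)] with s hs
  simp only [hterm, map_sum]
  rw [← Finset.sum_sdiff hs, hdiag, add_sub_assoc]
  refine add_mem (sum_mem fun l hl => hN l ?_ _ (sum_mem fun q _ => ha _ _)) ?_
  · simpa using (Finset.mem_sdiff.1 hl).2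
  · rw [← sub_add_sub_cancel _ (∑ m ∈ Finset.range N, p ^ m • z m), ← Finset.sum_sub_distrib]
    exact add_mem (sum_mem fun m _ => hzN m) hxN

/-- Division by a power of `p` is continuous on `B_dR⁺`. -/
theorem continuous_mul_of_pow_mul_eq_one {K : ℕ} {c : AInfInv p} (hc : p ^ K * c = 1) :
    Continuous fun x : BdRPlus p => algebraMap (AInfInv p) (BdRPlus p) c * x := by
  refine continuous_to_bdR p _ fun i => ?_
  let _ : TopologicalSpace (BdRQuot p i) := latticeTopology p (bdRLattice p i)
  have h : Continuous fun x : BdRQuot p i => Ideal.Quotient.mk (kerTheta p ^ i) c * x := by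
    refine continuous_of_subgroupsBasis _ _ _ _
      (AddMonoidHom.mulLeft (Ideal.Quotient.mk (kerTheta p ^ i) c)) fun n => ⟨n + K, ?_⟩
    rintro _ ⟨x, hx, rfl⟩
    refine ⟨x, hx, ?_⟩
    have hc' := congrArg (Ideal.Quotient.mk (kerTheta p ^ i)) hc
    simp only [map_mul, map_pow, map_natCast, map_one] at hc'
    simp only [nsmulAddMonoidHom_apply, AddMonoidHom.coe_mulLeft, nsmul_eq_mul, pow_add,
      Nat.cast_mul, Nat.cast_pow]
    linear_combination (-(p : BdRQuot p i) ^ n * x) * hc'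
  refine (h.comp (continuous_bdRReduction p i)).congr fun x => ?_
  rw [map_mul, AlgHom.commutes]
  rfl

/-- The version of `mem_acrys_of_tendsto` for series that start at the exponent `K` of `p`: their
limits lie in `p ^ K A_crys`. -/
theorem exists_eq_pow_smul_of_tendsto (K : ℕ) {z : ℕ → BdRPlus p} (hz : ∀ m, z m ∈ Acrys p)
    {x : BdRPlus p}
    (hx : Tendsto (fun N => ∑ m ∈ Finset.range N, p ^ (K + m) • z m) atTop (𝓝 x)) :
    ∃ x' ∈ Acrys p, x = p ^ K • x' := by
  obtain ⟨c, hc⟩ := ((isUnit_p p).pow K).exists_right_inv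
  have hc' := congrArg (algebraMap (AInfInv p) (BdRPlus p)) hc
  simp only [map_mul, map_pow, map_natCast, map_one] at hc'
  refine ⟨algebraMap (AInfInv p) (BdRPlus p) c * x, mem_acrys_of_tendsto p hz ?_, ?_⟩
  · refine (((continuous_mul_of_pow_mul_eq_one p hc).tendsto x).comp hx).congr fun N => ?_
    rw [Function.comp_apply, Finset.mul_sum]
    refine Finset.sum_congr rfl fun m _ => ?_
    simp only [nsmul_eq_mul, pow_add, Nat.cast_mul, Nat.cast_pow]
    linear_combination ((p : BdRPlus p) ^ m * z m) * hc'
  · simp only [nsmul_eq_mul, Nat.cast_pow]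
    linear_combination -x * hc'

instance : IsTopologicalAddGroup (BcrysPlus p) := AddGroupFilterBasis.isTopologicalAddGroup _

/-- The subgroup `p ^ n A_crys` of `B_crys⁺`. -/
def bcrysLattice (n : ℕ) : AddSubgroup (BcrysPlus p) :=
  latticeFamily p ((Acrys p).comap (BcrysPlus p).subtype.toAddMonoidHom) n

theorem bcrys_hasBasis : (𝓝 (0 : BcrysPlus p)).HasBasis (fun _ => True)
    (fun n => (bcrysLattice p n : Set (BcrysPlus p))) :=
  subgroupsBasis_hasBasis _ _

theorem mem_bcrysLattice {n : ℕ} {x : BcrysPlus p} :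
    x ∈ bcrysLattice p n ↔ ∃ z ∈ Acrys p, (x : BdRPlus p) = p ^ n • z := by
  constructor
  · rintro ⟨z, hz, rfl⟩
    exact ⟨z, hz, rfl⟩
  · rintro ⟨z, hz, hx⟩
    exact ⟨⟨z, 0, by simpa using hz⟩, hz, Subtype.ext hx.symm⟩

theorem bcrysLattice_anti {m n : ℕ} (h : m ≤ n) : bcrysLattice p n ≤ bcrysLattice p m := by
  intro x hx
  obtain ⟨z, hz, h'⟩ := (mem_bcrysLattice p).1 hx
  refine (mem_bcrysLattice p).2 ⟨p ^ (n - m) • z, (Acrys p).nsmul_mem hz _, ?_⟩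
  rw [h', smul_smul, ← pow_add, Nat.add_sub_cancel' h]

theorem isOpen_bcrysLattice (n : ℕ) : IsOpen (bcrysLattice p n : Set (BcrysPlus p)) :=
  AddSubgroup.isOpen_of_mem_nhds _ ((bcrys_hasBasis p).mem_of_mem (i := n) trivial)

/-- A Cauchy sequence of `B_crys⁺` that tends to `0` in `B_dR⁺` tends to `0` in `B_crys⁺`. -/
theorem tendsto_zero_of_bcrysToBdR {g : ℕ → BcrysPlus p}
    (hg : ∀ n, ∃ N, ∀ k ≥ N, ∀ l ≥ N, g k - g l ∈ bcrysLattice p n)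
    (h0 : Tendsto (fun k => bcrysToBdR p (g k)) atTop (𝓝 0)) : Tendsto g atTop (𝓝 0) := by
  choose N hN using hg
  -- Along `φ` the successive differences lie in `p ^ n A_crys`.
  let φ : ℕ → ℕ := fun n => n + ∑ j ∈ Finset.range (n + 1), N j
  have hφ : ∀ n, N n ≤ φ n := fun n =>
    (Finset.single_le_sum (fun _ _ => Nat.zero_le _) (Finset.self_mem_range_succ n)).trans
      (Nat.le_add_left _ _)
  have hφs : ∀ n, N n ≤ φ (n + 1) := fun n =>
    (Finset.single_le_sum (fun _ _ => Nat.zero_le _)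
      (Finset.mem_range.2 (by omega : n < n + 1 + 1))).trans (Nat.le_add_left _ _)
  have hφt : Tendsto φ atTop atTop := tendsto_atTop_mono (fun n => Nat.le_add_right _ _) tendsto_id
  choose z hz hgz using fun n =>
    (mem_bcrysLattice p).1 (hN n (φ n) (hφ n) (φ (n + 1)) (hφs n))
  refine (bcrys_hasBasis p).tendsto_right_iff.2 fun n _ => ?_
  have hn : g (φ n) ∈ bcrysLattice p n := by
    refine (mem_bcrysLattice p).2
      (exists_eq_pow_smul_of_tendsto p n (fun m => hz (n + m)) ?_)
    have h1 : Tendsto (fun k => bcrysToBdR p (g (φ (n + k)))) atTop (𝓝 0) :=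
      h0.comp (hφt.comp (tendsto_atTop_mono (fun k => Nat.le_add_left k n) tendsto_id))
    have h2 := (tendsto_const_nhds (x := bcrysToBdR p (g (φ n)))).sub h1
    rw [sub_zero] at h2
    refine h2.congr fun k => ?_
    rw [← Finset.sum_congr rfl fun m _ => hgz (n + m)]
    exact (Finset.sum_range_sub' (fun m => bcrysToBdR p (g (φ (n + m)))) k).symm
  filter_upwards [eventually_ge_atTop (N n)] with k hk
  rw [← sub_add_cancel (g k) (g (φ n))]
  exact add_mem (hN n k hk _ (hφ n)) hn

theorem continuous_projTensorLid_bcrys : Continuous (projTensorLid p (BcrysPlus p)) := by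
  refine continuous_of_subgroupsBasis _ _ _ _ (projTensorLid p (BcrysPlus p)) fun n => ?_
  refine ⟨(padicUnitBall p, ⟨bcrysLattice p n, isOpen_bcrysLattice p n⟩), fun x hx =>
    projTensorLid_mem p _ (fun c w hw => ?_) hx⟩
  obtain ⟨z, hz, h⟩ := (mem_bcrysLattice p).1 hw
  refine (mem_bcrysLattice p).2 ⟨(c : ℚ_[p]) • z, padicInt_smul_mem_acrys p c hz, ?_⟩
  rw [Submodule.coe_smul, h, smul_comm]

theorem continuous_projTensorLidInv_bcrys : Continuous (projTensorLidInv p (BcrysPlus p)) := by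
  refine continuous_of_subgroupsBasis _ _ _ _ (projTensorLidInv p (BcrysPlus p)) ?_
  rintro ⟨A, B⟩
  obtain ⟨n, -, hn⟩ := (bcrys_hasBasis p).mem_iff.1 (B.isOpen.mem_nhds B.zero_mem)
  have ht : Tendsto (fun k : ℕ => (p : ℚ_[p]) ^ k) atTop (𝓝 0) :=
    tendsto_pow_atTop_nhds_zero_of_norm_lt_one Padic.norm_p_lt_one
  obtain ⟨k, hk⟩ := (ht.eventually (A.isOpen.mem_nhds A.zero_mem)).exists
  refine ⟨n + k, ?_⟩
  rintro _ ⟨x, hx, rfl⟩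
  refine AddSubgroup.subset_closure ⟨_, hk, p ^ n • x, hn ⟨x, hx, rfl⟩, ?_⟩
  change (TensorProduct.lid ℚ_[p] (BcrysPlus p)).symm (p ^ (n + k) • x) = _
  rw [TensorProduct.lid_symm_apply, ← mul_one ((p : ℚ_[p]) ^ k), ← smul_eq_mul,
    TensorProduct.smul_tmul, ← Nat.cast_pow, Nat.cast_smul_eq_nsmul, smul_smul, ← pow_add,
    add_comm]

theorem continuous_projTensorLid_bdR : Continuous (projTensorLid p (BdRPlus p)) := by
  refine continuous_to_bdR p _ fun i => ?_
  let _ : TopologicalSpace (BdRQuot p i) := latticeTopology p (bdRLattice p i)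
  refine continuous_of_subgroupsBasis _ _ _ _
    ((bdRReduction p i : BdRPlus p →+ BdRQuot p i).comp (projTensorLid p (BdRPlus p))) fun n => ?_
  have hn : IsOpen (latticeFamily p (bdRLattice p i) n : Set (BdRQuot p i)) :=
    have : IsTopologicalAddGroup (BdRQuot p i) := AddGroupFilterBasis.isTopologicalAddGroup _
    AddSubgroup.isOpen_of_mem_nhds _ ((subgroupsBasis_hasBasis _
      (latticeFamily_directed p (bdRLattice p i))).mem_of_mem (i := n) trivial)
  refine ⟨(padicUnitBall p, (⟨_, hn⟩ : OpenAddSubgroup (BdRQuot p i)).comap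
    (bdRReduction p i : BdRPlus p →+ BdRQuot p i) (continuous_bdRReduction p i)), fun x hx =>
    projTensorLid_mem p _ (fun c w hw => ?_) hx⟩
  obtain ⟨b, hb, h⟩ := hw
  have hc : algebraMap ℚ_[p] (AInfInv p) c = algebraMap _ _ (padicIntToAInf p c) :=
    IsLocalization.lift_eq (M := nonZeroDivisors ℤ_[p]) (isUnit_padicInt p) c
  refine ⟨_, mul_mem_bdRLattice p i (padicIntToAInf p c) hb, ?_⟩
  have h1 : bdRReduction p i ((c : ℚ_[p]) • w) =
      Ideal.Quotient.mk (kerTheta p ^ i) (algebraMap ℚ_[p] (AInfInv p) c) * bdRReduction p i w := by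
    rw [Algebra.smul_def, map_mul]
    congr 1
  have h' : p ^ n • b = bdRReduction p i w := h
  change p ^ n • _ = bdRReduction p i ((c : ℚ_[p]) • w)
  rw [h1, hc, ← h', mul_smul_comm]

/-- The map from the completion of `B_crys⁺` to that of `B_dR⁺` is injective. -/
theorem CompletedTensor.map_id_padic_bcrysToBdR_injective :
    Function.Injective (CompletedTensor.map p (.id ℚ_[p] ℚ_[p]) (bcrysToBdR p)) := by
  let _ : UniformSpace (BcrysPlus p) := IsTopologicalAddGroup.rightUniformSpace _
  have _ : IsUniformAddGroup (BcrysPlus p) := isUniformAddGroup_of_addCommGroup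
  let _ : UniformSpace (BdRPlus p) := IsTopologicalAddGroup.rightUniformSpace _
  have _ : IsUniformAddGroup (BdRPlus p) := isUniformAddGroup_of_addCommGroup
  have _ : (𝓝 (0 : BcrysPlus p)).IsCountablyGenerated := (bcrys_hasBasis p).isCountablyGenerated
  refine CompletedTensor.map_id_padic_injective p (bcrysToBdR p)
    (continuous_projTensorLid_bcrys p) (continuous_projTensorLidInv_bcrys p)
    (continuous_projTensorLid_bdR p)
    (completion_injective_of_cauchySeq _ _ fun g hg h0 => tendsto_zero_of_bcrysToBdR p ?_ h0)
  intro n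
  refine (cauchySeq_iff.1 hg {q | q.1 - q.2 ∈ bcrysLattice p n} ?_)
  rw [uniformity_eq_comap_nhds_zero_swapped]
  exact ⟨_, (bcrys_hasBasis p).mem_of_mem (i := n) trivial, fun _ h => h⟩

/-- The open subgroups of `B_crys⁺` are absorbing. -/
theorem exists_smul_mem_of_bcrys (w : BcrysPlus p) (B : OpenAddSubgroup (BcrysPlus p)) :
    ∃ c : ℚ_[p], c ≠ 0 ∧ c • w ∈ B := by
  obtain ⟨n, -, hn⟩ := (bcrys_hasBasis p).mem_iff.1 (B.isOpen.mem_nhds B.zero_mem)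
  obtain ⟨k, hk⟩ := w.2
  refine ⟨((p ^ (n + k) : ℕ) : ℚ_[p]), ?_, hn ((mem_bcrysLattice p).2 ⟨_, hk, ?_⟩)⟩
  · exact_mod_cast pow_ne_zero _ (Fact.out : p.Prime).ne_zero
  · rw [Nat.cast_smul_eq_nsmul, pow_add, mul_smul]
    rfl

end Periods

end

end PadicPeriod

/-- With `S_M = L⟨p ^ (-M) T⟩` and `S_{M,M+1} = L⟨p ^ (-M) T, p ^ (M + 1) T⁻¹⟩`, the natural maps
of `S_M ⊗̂ B_dR⁺`, `S_{M,M+1} ⊗̂ B_crys⁺` and `S_M ⊗̂ B_crys⁺` to `S_{M,M+1} ⊗̂ B_dR⁺` are injective,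
and the intersection of the images of the first two is the image of the third. -/
theorem mainTheorem3 (p : ℕ) [Fact p.Prime] (L : Type*) [NormedField L]
    [NormedAlgebra ℚ_[p] L] [FiniteDimensional ℚ_[p] L] (M : ℕ) :
    let jDR := CompletedTensor.map p (diskToAnnulus p L M (M + 1) M.le_succ)
      (ContinuousLinearMap.id ℚ_[p] (BdRPlus p))
    let jCrys := CompletedTensor.map p (ContinuousLinearMap.id ℚ_[p] (Annulus p L M (M + 1)))
      (bcrysToBdR p)
    let j := CompletedTensor.map p (diskToAnnulus p L M (M + 1) M.le_succ) (bcrysToBdR p)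
    Function.Injective jDR ∧ Function.Injective jCrys ∧ Function.Injective j ∧
      jDR.range ⊓ jCrys.range = j.range := by
  have h := annulusToDisk_comp_diskToAnnulus p L M (M + 1) M.le_succ
  have hCrys := CompletedTensor.map_id_annulus_injective p L M (M + 1) M.le_succ (bcrysToBdR p)
    (CompletedTensor.map_id_padic_bcrysToBdR_injective p) (exists_smul_mem_of_bcrys p)
  exact ⟨(CompletedTensor.map_left_leftInverse p h).injective, hCrys,
    CompletedTensor.map_injective_of_leftInverse p h hCrys,
    CompletedTensor.range_inf_range_of_leftInverse p h (bcrysToBdR p)⟩
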